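/- Let $\mathcal H_A,\mathcal H_B$ be finite-dimensional complex Hilbert spaces, $d_B=\dim\mathcal H_B$, and let $\mathscr B=\{\mathcal B_x\}_{x=1}^m$ ($m\ge 1$), $\mathcal B_x=\{|\psi_{xk}\rangle\}_k$, be any set of orthonormal bases of $\mathcal H_A$. Its transition graph has one vertex for each pair $(x,k)$, and two different vertices $(x,k)$ and $(y,l)$ are adjacent iff $\langle\psi_{xk}|\psi_{yl}\rangle\neq 0$; let $G_1,\dots,G_g$ be its connected components. For each $a$, the component subspace $\mathcal H_{A,a}$ is the span of the $|\psi_{xk}\rangle$ with $(x,k)\in G_a$, the component projector is $P_a=\sum_{k:(x,k)\in G_a}|\psi_{xk}\rangle\langle\psi_{xk}|$, and the component rank is $r_a=\operatorname{tr}P_a$ (for a fixed basis index $x$; none of these depends on the choice of $x$). A state $\rho$ (density operator, pure or mixed) on $\mathcal H_A\otimes\mathcal H_B$ is a zero-uncertainty state with respect to $\mathscr B$ if for each $x$ there is a POVM $\{\Pi_{xk}\}_k$ on $\mathcal H_B$ with $\sum_k\operatorname{tr}[\rho(|\psi_{xk}\rangle\langle\psi_{xk}|\otimes\Pi_{xk})]=1$.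 A state on $\mathcal H\otimes\mathcal H_B$ is maximally entangled if every state on $\mathcal H\otimes\mathcal H_B$ can be created from it by local operations and classical communication (LOCC); a subnormalized maximally entangled state is a multiple $q\,\sigma$, $0<q\le 1$, of a maximally entangled state $\sigma$. Theorem. Let $\rho$ be a state on $\mathcal H_A\otimes\mathcal H_B$ and $\rho_a=(P_a\otimes 1)\rho(P_a\otimes 1)$. Then $\rho$ is a zero-uncertainty state with respect to $\mathscr B$ if and only if the following three conditions hold: 1. $r_a\le d_B$ whenever $\operatorname{tr}\rho_a>0$; 2. each $\rho_a$ with $\operatorname{tr}\rho_a>0$ is a subnormalized maximally entangled state on $\mathcal H_{A,a}\otimes\mathcal H_B$; 3. the operators $\operatorname{tr}_A\rho_a$, $a=1,\dots,g$, have mutually orthogonal supports. -/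

import Mathlib

open scoped TensorProduct

noncomputable section

namespace ZeroUncertainty

universe u v

/-! ## States on finite-dimensional Hilbert spaces -/

section Basic

variable {E F : Type*} [NormedAddCommGroup E] [InnerProductSpace ℂ E] [FiniteDimensional ℂ E]
  [NormedAddCommGroup F] [InnerProductSpace ℂ F] [FiniteDimensional ℂ F]

/-- A quantum state (density operator): a positive semidefinite operator of unit trace. -/
def IsState (T : E →ₗ[ℂ] E) : Prop :=
  T.IsPositive ∧ LinearMap.trace ℂ E T = 1

/-- The rank-one operator `|ψ⟩⟨ψ|`. -/
def ketBra (ψ : E) : E →ₗ[ℂ] E :=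
  (InnerProductSpace.rankOne ℂ ψ ψ).toLinearMap

/-- The support of an operator: the orthogonal complement of its kernel. -/
def support (T : E →ₗ[ℂ] E) : Submodule ℂ E :=
  (LinearMap.ker T)ᗮ

/-- Conjugation `T ↦ K T K†` by an operator `K : E → F`. -/
def conjBy (K : E →ₗ[ℂ] F) : (E →ₗ[ℂ] E) →ₗ[ℂ] (F →ₗ[ℂ] F) where
  toFun T := K ∘ₗ T ∘ₗ LinearMap.adjoint K
  map_add' S T := by rw [LinearMap.add_comp, LinearMap.comp_add]
  map_smul' c T := by rw [LinearMap.smul_comp, LinearMap.comp_smul, RingHom.id_apply]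

/-- The operators `K i` are the Kraus operators of a complete local measurement:
`∑ i, (K i)† (K i) = 1`. -/
def IsKraus {n : ℕ} (K : Fin n → (E →ₗ[ℂ] F)) : Prop :=
  ∑ i, LinearMap.adjoint (K i) ∘ₗ K i = LinearMap.id

end Basic

/-! ## Bipartite operators -/

section Bipartite

variable {A B : Type*} [NormedAddCommGroup A] [InnerProductSpace ℂ A] [FiniteDimensional ℂ A]
  [NormedAddCommGroup B] [InnerProductSpace ℂ B] [FiniteDimensional ℂ B]

/-- The conditional operator `⟨ψ|T|ψ⟩` of Bob, for a vector `ψ` of Alice: the operator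
`(⟨ψ| ⊗ 1) T (|ψ⟩ ⊗ 1)` on `B`. -/
def condOp (ψ : A) (T : A ⊗[ℂ] B →ₗ[ℂ] A ⊗[ℂ] B) : B →ₗ[ℂ] B :=
  LinearMap.adjoint (TensorProduct.mk ℂ A B ψ) ∘ₗ T ∘ₗ TensorProduct.mk ℂ A B ψ

/-- The partial trace `tr_A T = ∑ i, ⟨e i|T|e i⟩` over an orthonormal basis of `A`. -/
def partialTraceA (T : A ⊗[ℂ] B →ₗ[ℂ] A ⊗[ℂ] B) : B →ₗ[ℂ] B :=
  ∑ i, condOp (stdOrthonormalBasis ℂ A i) T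

/-- An operator on `A ⊗ B` compressed to `K ⊗ B`, for a subspace `K` of `A`. For an operator that
is supported on `K ⊗ B`, this is the same operator regarded as an operator on `K ⊗ B`. -/
def restrictA (K : Submodule ℂ A) (T : A ⊗[ℂ] B →ₗ[ℂ] A ⊗[ℂ] B) :
    (K ⊗[ℂ] B) →ₗ[ℂ] (K ⊗[ℂ] B) :=
  conjBy ((LinearMap.adjoint K.subtype).rTensor B) T

end Bipartite

/-! ## LOCC and maximally entangled states -/

/-- `IsLOCC Λ`: the linear map `Λ`, from operators on `A ⊗ B` to operators on `A' ⊗ B'`, is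
realized by a protocol of local operations and classical communication with finitely many rounds.
Either nothing more is done; or one of the parties performs a local measurement with finitely many
outcomes, described by Kraus operators into an arbitrary finite-dimensional local space (so local
ancillas, local channels and discarding local systems are covered), the outcome is announced,
and the parties continue with an LOCC protocol that may depend on the outcome. -/
inductive IsLOCC {A' : Type u} {B' : Type v}
    [NormedAddCommGroup A'] [InnerProductSpace ℂ A'] [FiniteDimensional ℂ A']
    [NormedAddCommGroup B'] [InnerProductSpace ℂ B'] [FiniteDimensional ℂ B'] :
    ∀ {A : Type u} {B : Type v}
    [NormedAddCommGroup A] [InnerProductSpace ℂ A] [FiniteDimensional ℂ A]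
    [NormedAddCommGroup B] [InnerProductSpace ℂ B] [FiniteDimensional ℂ B],
    ((A ⊗[ℂ] B →ₗ[ℂ] A ⊗[ℂ] B) →ₗ[ℂ] (A' ⊗[ℂ] B' →ₗ[ℂ] A' ⊗[ℂ] B')) → Prop
  | nil : IsLOCC (LinearMap.id : (A' ⊗[ℂ] B' →ₗ[ℂ] A' ⊗[ℂ] B') →ₗ[ℂ] _)
  | alice {A C : Type u} {B : Type v}
      [NormedAddCommGroup A] [InnerProductSpace ℂ A] [FiniteDimensional ℂ A]
      [NormedAddCommGroup C] [InnerProductSpace ℂ C] [FiniteDimensional ℂ C]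
      [NormedAddCommGroup B] [InnerProductSpace ℂ B] [FiniteDimensional ℂ B]
      {n : ℕ} (K : Fin n → (A →ₗ[ℂ] C)) (hK : IsKraus K)
      (Λ : Fin n → ((C ⊗[ℂ] B →ₗ[ℂ] C ⊗[ℂ] B) →ₗ[ℂ] (A' ⊗[ℂ] B' →ₗ[ℂ] A' ⊗[ℂ] B')))
      (hΛ : ∀ i, IsLOCC (Λ i)) :
      IsLOCC (∑ i, Λ i ∘ₗ conjBy ((K i).rTensor B))
  | bob {A : Type u} {B C : Type v}
      [NormedAddCommGroup A] [InnerProductSpace ℂ A] [FiniteDimensional ℂ A]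
      [NormedAddCommGroup B] [InnerProductSpace ℂ B] [FiniteDimensional ℂ B]
      [NormedAddCommGroup C] [InnerProductSpace ℂ C] [FiniteDimensional ℂ C]
      {n : ℕ} (K : Fin n → (B →ₗ[ℂ] C)) (hK : IsKraus K)
      (Λ : Fin n → ((A ⊗[ℂ] C →ₗ[ℂ] A ⊗[ℂ] C) →ₗ[ℂ] (A' ⊗[ℂ] B' →ₗ[ℂ] A' ⊗[ℂ] B')))
      (hΛ : ∀ i, IsLOCC (Λ i)) :
      IsLOCC (∑ i, Λ i ∘ₗ conjBy ((K i).lTensor A))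

section MES

variable {A : Type u} {B : Type v}
  [NormedAddCommGroup A] [InnerProductSpace ℂ A] [FiniteDimensional ℂ A]
  [NormedAddCommGroup B] [InnerProductSpace ℂ B] [FiniteDimensional ℂ B]

/-- A maximally entangled state (MES) on `A ⊗ B`: a state from which every state on `A ⊗ B` can be
created by LOCC. -/
def IsMES (ρ : A ⊗[ℂ] B →ₗ[ℂ] A ⊗[ℂ] B) : Prop :=
  IsState ρ ∧ ∀ σ : A ⊗[ℂ] B →ₗ[ℂ] A ⊗[ℂ] B, IsState σ →
    ∃ Λ : (A ⊗[ℂ] B →ₗ[ℂ] A ⊗[ℂ] B) →ₗ[ℂ] (A ⊗[ℂ] B →ₗ[ℂ] A ⊗[ℂ] B), IsLOCC Λ ∧ Λ ρ = σ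

/-- A subnormalized MES: a positive multiple `q ρ`, with `q ≤ 1`, of an MES `ρ`. -/
def IsSubnormalizedMES (T : A ⊗[ℂ] B →ₗ[ℂ] A ⊗[ℂ] B) : Prop :=
  ∃ (q : ℝ) (ρ : A ⊗[ℂ] B →ₗ[ℂ] A ⊗[ℂ] B), 0 < q ∧ q ≤ 1 ∧ IsMES ρ ∧ T = (q : ℂ) • ρ

end MES

/-! ## Basis sets, transition graphs and zero-uncertainty states -/

section BasisSet

variable {HA : Type u} {HB : Type v}
  [NormedAddCommGroup HA] [InnerProductSpace ℂ HA] [FiniteDimensional ℂ HA]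
  [NormedAddCommGroup HB] [InnerProductSpace ℂ HB] [FiniteDimensional ℂ HB]
  {m d : ℕ}

/-- A POVM on `HB` with outcomes `Fin d`. -/
def IsPOVM (M : Fin d → (HB →ₗ[ℂ] HB)) : Prop :=
  (∀ k, (M k).IsPositive) ∧ ∑ k, M k = LinearMap.id

/-- The probability `∑ k, tr[ρ (|ψ k⟩⟨ψ k| ⊗ M k)]` that Bob, measuring the POVM `M`, guesses
the outcome of Alice's measurement on the basis `ψ`. -/
def guessProb (ψ : OrthonormalBasis (Fin d) ℂ HA) (M : Fin d → (HB →ₗ[ℂ] HB))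
    (ρ : HA ⊗[ℂ] HB →ₗ[ℂ] HA ⊗[ℂ] HB) : ℂ :=
  ∑ k, LinearMap.trace ℂ (HA ⊗[ℂ] HB) (ρ ∘ₗ TensorProduct.map (ketBra (ψ k)) (M k))

/-- `ρ` is a zero-uncertainty state (ZUS) with respect to the basis set `ℬ`: for each basis, Bob
has a measurement that predicts the outcome of Alice with certainty. -/
def IsZUS (ℬ : Fin m → OrthonormalBasis (Fin d) ℂ HA)
    (ρ : HA ⊗[ℂ] HB →ₗ[ℂ] HA ⊗[ℂ] HB) : Prop :=
  ∀ x, ∃ M : Fin d → (HB →ₗ[ℂ] HB), IsPOVM M ∧ guessProb (ℬ x) M ρ = 1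

/-- The transition graph of a basis set: its vertices are the pairs `(x, k)`, standing for the
`k`-th state of the `x`-th basis; two different vertices are adjacent iff the corresponding
states are not orthogonal. -/
def transitionGraph (ℬ : Fin m → OrthonormalBasis (Fin d) ℂ HA) :
    SimpleGraph (Fin m × Fin d) where
  Adj p q := p ≠ q ∧ inner ℂ (ℬ p.1 p.2) (ℬ q.1 q.2) ≠ 0
  symm := ⟨fun _ _ h => ⟨h.1.symm, fun h0 => h.2 (inner_eq_zero_symm.mp h0)⟩⟩
  loopless := ⟨fun _ h => h.1 rfl⟩

/-- The irreducible components of a basis set, labelled by the connected components of its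
transition graph. -/
abbrev Component (ℬ : Fin m → OrthonormalBasis (Fin d) ℂ HA) : Type :=
  (transitionGraph ℬ).ConnectedComponent

/-- The component subspace: the span of those states of the basis `ℬ x` that belong to the
component `a` (it does not depend on the choice of `x`). -/
def componentSubspace (ℬ : Fin m → OrthonormalBasis (Fin d) ℂ HA) (x : Fin m)
    (a : Component ℬ) : Submodule ℂ HA :=
  Submodule.span ℂ {ψ | ∃ k, (x, k) ∈ a.supp ∧ ℬ x k = ψ}

open Classical in
/-- The component projector `P_a`: the sum of `|ψ⟩⟨ψ|` over those states `ψ` of the basis `ℬ x`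
that belong to the component `a` (it does not depend on the choice of `x`). -/
def componentProj (ℬ : Fin m → OrthonormalBasis (Fin d) ℂ HA) (x : Fin m)
    (a : Component ℬ) : HA →ₗ[ℂ] HA :=
  ∑ k with (x, k) ∈ a.supp, ketBra (ℬ x k)

/-- The component rank `r_a = tr P_a` (a natural number, written as a real number). -/
def componentRank (ℬ : Fin m → OrthonormalBasis (Fin d) ℂ HA) (x : Fin m)
    (a : Component ℬ) : ℝ :=
  (LinearMap.trace ℂ HA (componentProj ℬ x a)).re

/-- `ρ_a = (P_a ⊗ 1) ρ (P_a ⊗ 1)`. -/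
def componentState (ℬ : Fin m → OrthonormalBasis (Fin d) ℂ HA) (x : Fin m)
    (ρ : HA ⊗[ℂ] HB →ₗ[ℂ] HA ⊗[ℂ] HB) (a : Component ℬ) : HA ⊗[ℂ] HB →ₗ[ℂ] HA ⊗[ℂ] HB :=
  (componentProj ℬ x a).rTensor HB ∘ₗ ρ ∘ₗ (componentProj ℬ x a).rTensor HB

end BasisSet

end ZeroUncertainty

end

open ZeroUncertainty

/-!
Write `ρ = R R†`. Everything is encoded in the Gram operators `Γ(ψ, φ) = R† (|ψ⟩⟨φ| ⊗ 1) R` of the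
slices of `R`. Bob can guess the outcome in a basis iff his unnormalized conditional states are
mutually orthogonal, that is, iff `Γ` has no off-diagonal entries in this basis. If this holds in
two bases, then expanding `Γ(ψ, φ)`, for `ψ` in one and `φ` in the other, in either of them gives
`⟨φ|ψ⟩ Γ(ψ, ψ) = ⟨φ|ψ⟩ Γ(φ, φ)`, so the diagonal of `Γ` is constant along the edges of the
transition graph. Hence `Γ` is a multiple `⟨φ|ψ⟩ G` of the inner product on each component subspace,
and vanishes between different ones.

The form `Γ(ψ, φ) = ⟨φ|ψ⟩ G` characterizes maximal entanglement (up to a factor) when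
`dim A ≤ dim B`. If `R R†` can be converted to a maximally entangled vector by LOCC, hence by a
separable map, then a fidelity bound for separable maps must be tight, which forces this form.
Conversely, to create `σ = ∑ᵢ |σᵢ⟩⟨σᵢ|`, Bob first measures which of several maximally entangled
vectors is present, draws `i` at random, and measures a cyclic shift in the Schmidt basis of `σᵢ`,
with Kraus operators carrying the Schmidt coefficients; Alice then undoes the shift.
-/

noncomputable section

namespace ZeroUncertainty

universe u v

section KetBra

variable {E F G ι : Type*} [NormedAddCommGroup E] [InnerProductSpace ℂ E]
  [NormedAddCommGroup F] [InnerProductSpace ℂ F] [NormedAddCommGroup G] [InnerProductSpace ℂ G]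
  [Fintype ι]

lemma inner_self_eq_ofReal (ψ : E) : inner ℂ ψ ψ = ((‖ψ‖ ^ 2 : ℝ) : ℂ) := by
  rw [inner_self_eq_norm_sq_to_K]
  norm_cast

@[simp] lemma ketBra_apply (ψ φ : E) : ketBra ψ φ = inner ℂ ψ φ • ψ := rfl

@[simp] lemma ketBra_zero : ketBra (0 : E) = 0 := by
  ext
  simp

lemma ketBra_ofReal_smul (c : ℝ) (v : E) :
    ketBra ((c : ℂ) • v) = ((c ^ 2 : ℝ) : ℂ) • ketBra v := by
  ext x
  simp only [ketBra_apply, inner_smul_left, LinearMap.smul_apply, smul_smul, Complex.conj_ofReal]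
  push_cast
  ring_nf

lemma isPositive_ketBra (ψ : E) : (ketBra ψ).IsPositive :=
  (InnerProductSpace.isPositive_rankOne_self ψ).toLinearMap

lemma inner_ketBra_apply_self (ψ φ : E) :
    inner ℂ φ (ketBra ψ φ) = ((‖(inner ℂ φ ψ : ℂ)‖ ^ 2 : ℝ) : ℂ) := by
  rw [ketBra_apply, inner_smul_right, ← inner_conj_symm ψ φ, RCLike.conj_mul]
  norm_cast

lemma sum_ketBra (b : OrthonormalBasis ι ℂ E) : ∑ i, ketBra (b i) = LinearMap.id := by
  ext x
  simp [LinearMap.sum_apply, b.sum_repr' x]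

variable [FiniteDimensional ℂ E]

lemma trace_ketBra (ψ : E) : LinearMap.trace ℂ E (ketBra ψ) = (‖ψ‖ : ℂ) ^ 2 :=
  (InnerProductSpace.trace_rankOne ψ ψ).trans (inner_self_eq_norm_sq_to_K ψ)

variable [FiniteDimensional ℂ F]

lemma sum_norm_sq_of_sum_adjoint_comp {K : ι → E →ₗ[ℂ] F}
    (hK : ∑ i, LinearMap.adjoint (K i) ∘ₗ K i = LinearMap.id) (v : E) :
    ∑ i, ‖K i v‖ ^ 2 = ‖v‖ ^ 2 := by
  have h : inner ℂ v ((∑ i, LinearMap.adjoint (K i) ∘ₗ K i) v) = inner ℂ v v := by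
    rw [hK, LinearMap.id_apply]
  simp_rw [LinearMap.sum_apply, inner_sum, LinearMap.comp_apply, LinearMap.adjoint_inner_right,
    inner_self_eq_norm_sq_to_K] at h
  exact_mod_cast h

lemma comp_adjoint_eq_sum_ketBra (b : OrthonormalBasis ι ℂ E) (R : E →ₗ[ℂ] F) :
    R ∘ₗ LinearMap.adjoint R = ∑ i, ketBra (R (b i)) := by
  ext x
  conv_lhs => rw [LinearMap.comp_apply, ← b.sum_repr' (LinearMap.adjoint R x)]
  simp [LinearMap.sum_apply, LinearMap.adjoint_inner_right]

lemma trace_comp_adjoint (b : OrthonormalBasis ι ℂ E) (R : E →ₗ[ℂ] F) :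
    LinearMap.trace ℂ F (R ∘ₗ LinearMap.adjoint R) = ((∑ i, ‖R (b i)‖ ^ 2 : ℝ) : ℂ) := by
  rw [comp_adjoint_eq_sum_ketBra b, map_sum]
  push_cast
  exact Finset.sum_congr rfl fun i _ => trace_ketBra _

lemma conjBy_ketBra (K : E →ₗ[ℂ] F) (ψ : E) : conjBy K (ketBra ψ) = ketBra (K ψ) := by
  ext x
  simp [conjBy, LinearMap.adjoint_inner_right]

variable [FiniteDimensional ℂ G]

lemma conjBy_conjBy (L : F →ₗ[ℂ] G) (K : E →ₗ[ℂ] F) (T : E →ₗ[ℂ] E) :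
    conjBy L (conjBy K T) = conjBy (L ∘ₗ K) T := by
  simp [conjBy, LinearMap.adjoint_comp, LinearMap.comp_assoc]

lemma conjBy_comp_adjoint (K : F →ₗ[ℂ] G) (R : E →ₗ[ℂ] F) :
    conjBy K (R ∘ₗ LinearMap.adjoint R) = (K ∘ₗ R) ∘ₗ LinearMap.adjoint (K ∘ₗ R) := by
  simp [conjBy, LinearMap.adjoint_comp, LinearMap.comp_assoc]

end KetBra

section Positive

variable {E F : Type*} [NormedAddCommGroup E] [InnerProductSpace ℂ E] [FiniteDimensional ℂ E]
  [NormedAddCommGroup F] [InnerProductSpace ℂ F] [FiniteDimensional ℂ F]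

lemma exists_eq_sum_ketBra {T : E →ₗ[ℂ] E} (hT : T.IsPositive) :
    ∃ (n : ℕ) (u : Fin n → E), T = ∑ i, ketBra (u i) := by
  obtain ⟨n, u, hu⟩ := ContinuousLinearMap.isPositive_iff_eq_sum_rankOne.1
    (LinearMap.isPositive_toContinuousLinearMap_iff T |>.2 hT)
  refine ⟨n, u, LinearMap.ext fun x => ?_⟩
  simpa [LinearMap.sum_apply] using congr($hu x)

lemma exists_eq_comp_adjoint {T : E →ₗ[ℂ] E} (hT : T.IsPositive) :
    ∃ (n : ℕ) (R : EuclideanSpace ℂ (Fin n) →ₗ[ℂ] E), T = R ∘ₗ LinearMap.adjoint R := by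
  obtain ⟨n, u, rfl⟩ := exists_eq_sum_ketBra hT
  let e := EuclideanSpace.basisFun (Fin n) ℂ
  refine ⟨n, e.toBasis.constr ℂ u, ?_⟩
  rw [comp_adjoint_eq_sum_ketBra e, ← e.coe_toBasis]
  simp_rw [Module.Basis.constr_basis]

lemma exists_eigenbasis {T : E →ₗ[ℂ] E} (hT : T.IsPositive) :
    ∃ (b : OrthonormalBasis (Fin (Module.finrank ℂ E)) ℂ E) (μ : Fin (Module.finrank ℂ E) → ℝ),
      (∀ i, 0 ≤ μ i) ∧ ∀ i, T (b i) = (μ i : ℂ) • b i :=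
  ⟨hT.isSymmetric.eigenvectorBasis rfl, hT.isSymmetric.eigenvalues rfl,
    hT.nonneg_eigenvalues rfl, hT.isSymmetric.apply_eigenvectorBasis rfl⟩

lemma eq_zero_of_trace_comp_adjoint {R : E →ₗ[ℂ] F}
    (h : LinearMap.trace ℂ F (R ∘ₗ LinearMap.adjoint R) = 0) : R = 0 := by
  let e := stdOrthonormalBasis ℂ E
  rw [trace_comp_adjoint e, Complex.ofReal_eq_zero,
    Finset.sum_eq_zero_iff_of_nonneg fun i _ => by positivity] at h
  exact e.toBasis.ext fun i => by simpa using h i (Finset.mem_univ i)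

lemma re_trace_comp_adjoint_pos {R : E →ₗ[ℂ] F} (hR : R ≠ 0) :
    0 < (LinearMap.trace ℂ F (R ∘ₗ LinearMap.adjoint R)).re := by
  have htrace := trace_comp_adjoint (stdOrthonormalBasis ℂ E) R
  rw [htrace, Complex.ofReal_re]
  refine (Finset.sum_nonneg fun i _ => by positivity).lt_of_ne' fun h0 => hR ?_
  exact eq_zero_of_trace_comp_adjoint (htrace.trans (by rw [h0, Complex.ofReal_zero]))

lemma eq_zero_of_isPositive_of_trace {T : E →ₗ[ℂ] E} (hT : T.IsPositive)
    (h : LinearMap.trace ℂ E T = 0) : T = 0 := by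
  obtain ⟨n, R, rfl⟩ := exists_eq_comp_adjoint hT
  rw [eq_zero_of_trace_comp_adjoint h, LinearMap.zero_comp]

lemma apply_eq_zero_of_isPositive_of_inner {T : E →ₗ[ℂ] E} (hT : T.IsPositive) {x : E}
    (h : inner ℂ x (T x) = 0) : T x = 0 := by
  obtain ⟨n, R, rfl⟩ := exists_eq_comp_adjoint hT
  rw [LinearMap.comp_apply, ← LinearMap.adjoint_inner_left, inner_self_eq_zero] at h
  rw [LinearMap.comp_apply, h, map_zero]

lemma isState_smul_ketBra {ψ : E} (hψ : ψ ≠ 0) :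
    IsState ((((‖ψ‖ ^ 2)⁻¹ : ℝ) : ℂ) • ketBra ψ) := by
  refine ⟨(isPositive_ketBra ψ).smul_of_nonneg (Complex.zero_le_real.2 (by positivity)), ?_⟩
  rw [map_smul, trace_ketBra, smul_eq_mul, ← Complex.ofReal_pow, ← Complex.ofReal_mul,
    inv_mul_cancel₀ (pow_ne_zero 2 (norm_ne_zero_iff.2 hψ)), Complex.ofReal_one]

lemma exists_orthonormalBasis_smul_eq {e : E} (he : e ≠ 0) :
    ∃ (b : OrthonormalBasis (Fin (Module.finrank ℂ E)) ℂ E) (i : _), (‖e‖ : ℂ) • b i = e := by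
  have : Nontrivial E := ⟨e, 0, he⟩
  let i₀ : Fin (Module.finrank ℂ E) := ⟨0, Module.finrank_pos⟩
  obtain ⟨b, hb⟩ := Orthonormal.exists_orthonormalBasis_extension_of_card_eq (𝕜 := ℂ)
    (ι := Fin (Module.finrank ℂ E)) (by simp) (v := fun _ => (‖e‖⁻¹ : ℂ) • e) (s := {i₀})
    ⟨fun _ => norm_smul_inv_norm he, fun i j hij => (hij (Subsingleton.elim _ _)).elim⟩
  refine ⟨b, i₀, ?_⟩
  rw [hb i₀ rfl, smul_inv_smul₀ (Complex.ofReal_ne_zero.2 (norm_ne_zero_iff.2 he))]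

lemma adjoint_id_sub_comp {P : E →ₗ[ℂ] E} (hP : P.IsSymmetricProjection) :
    LinearMap.adjoint (LinearMap.id - P) ∘ₗ (LinearMap.id - P) = LinearMap.id - P := by
  have hQ : IsStarProjection (LinearMap.id - P) :=
    (LinearMap.isStarProjection_iff_isSymmetricProjection.2 hP).one_sub
  rw [← LinearMap.star_eq_adjoint, hQ.isSelfAdjoint.star_eq]
  exact hQ.isIdempotentElem

end Positive

section Bra

variable {A A' B B' ι : Type*} [NormedAddCommGroup A] [InnerProductSpace ℂ A]
  [FiniteDimensional ℂ A] [NormedAddCommGroup B] [InnerProductSpace ℂ B] [FiniteDimensional ℂ B]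
  [NormedAddCommGroup A'] [InnerProductSpace ℂ A'] [FiniteDimensional ℂ A']
  [NormedAddCommGroup B'] [InnerProductSpace ℂ B'] [FiniteDimensional ℂ B'] [Fintype ι]

/-- The partial contraction `⟨ψ| ⊗ 1 : A ⊗ B → B`, semilinear in `ψ`. The vector `bra ψ v` of `B`
is called the slice of `v` at `ψ`. -/
def bra : A →ₗ⋆[ℂ] (A ⊗[ℂ] B →ₗ[ℂ] B) :=
  (LinearMap.adjoint (𝕜 := ℂ) (E := B) (F := A ⊗[ℂ] B)).toLinearMap ∘ₛₗ TensorProduct.mk ℂ A B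

lemma adjoint_bra (ψ : A) :
    LinearMap.adjoint (bra ψ : A ⊗[ℂ] B →ₗ[ℂ] B) = TensorProduct.mk ℂ A B ψ :=
  LinearMap.adjoint_adjoint _

lemma inner_bra (ψ : A) (b : B) (v : A ⊗[ℂ] B) : inner ℂ b (bra ψ v) = inner ℂ (ψ ⊗ₜ[ℂ] b) v := by
  rw [← LinearMap.adjoint_inner_left, adjoint_bra, TensorProduct.mk_apply]

@[simp] lemma bra_tmul (ψ a : A) (b : B) : bra ψ (a ⊗ₜ[ℂ] b) = inner ℂ ψ a • b :=
  ext_inner_left ℂ fun c => by rw [inner_bra, TensorProduct.inner_tmul, inner_smul_right]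

lemma bra_map (ψ : A') (f : A →ₗ[ℂ] A') (g : B →ₗ[ℂ] B') (v : A ⊗[ℂ] B) :
    bra ψ (TensorProduct.map f g v) = g (bra (LinearMap.adjoint f ψ) v) := by
  have h : bra ψ ∘ₗ TensorProduct.map f g = g ∘ₗ bra (LinearMap.adjoint f ψ) :=
    TensorProduct.ext' fun a b => by simp [LinearMap.adjoint_inner_left]
  exact congr($h v)

lemma bra_rTensor (ψ : A') (f : A →ₗ[ℂ] A') (v : A ⊗[ℂ] B) :
    bra ψ (f.rTensor B v) = bra (LinearMap.adjoint f ψ) v :=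
  bra_map ψ f LinearMap.id v

lemma sum_tmul_bra (h : OrthonormalBasis ι ℂ A) (v : A ⊗[ℂ] B) :
    ∑ i, h i ⊗ₜ[ℂ] bra (h i) v = v := by
  induction v using TensorProduct.induction_on with
  | zero => simp
  | tmul a b =>
    simp_rw [bra_tmul, ← TensorProduct.smul_tmul, ← TensorProduct.sum_tmul]
    rw [h.sum_repr' a]
  | add v w hv hw => simp_rw [map_add, TensorProduct.tmul_add, Finset.sum_add_distrib, hv, hw]

lemma ext_bra (h : OrthonormalBasis ι ℂ A) {v w : A ⊗[ℂ] B}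
    (hvw : ∀ i, bra (h i) v = bra (h i) w) : v = w := by
  rw [← sum_tmul_bra h v, ← sum_tmul_bra h w]
  simp_rw [hvw]

lemma inner_eq_sum_bra (h : OrthonormalBasis ι ℂ A) (v w : A ⊗[ℂ] B) :
    inner ℂ v w = ∑ i, inner ℂ (bra (h i) v) (bra (h i) w) := by
  conv_lhs => rw [← sum_tmul_bra h v]
  simp_rw [sum_inner, inner_bra]

lemma norm_sq_eq_sum_bra (h : OrthonormalBasis ι ℂ A) (v : A ⊗[ℂ] B) :
    ‖v‖ ^ 2 = ∑ i, ‖bra (h i) v‖ ^ 2 := by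
  have key := inner_eq_sum_bra h v v
  rw [inner_self_eq_ofReal v] at key
  simp_rw [inner_self_eq_ofReal] at key
  exact_mod_cast key

end Bra

section SliceGram

variable {A B E : Type*} [NormedAddCommGroup A] [InnerProductSpace ℂ A] [FiniteDimensional ℂ A]
  [NormedAddCommGroup B] [InnerProductSpace ℂ B] [FiniteDimensional ℂ B]
  [NormedAddCommGroup E] [InnerProductSpace ℂ E] [FiniteDimensional ℂ E]

/-- The Gram operator `R† (|ψ⟩⟨φ| ⊗ 1) R` of the slices of `R` at `ψ` and `φ`. -/
def sliceGram (R : E →ₗ[ℂ] A ⊗[ℂ] B) : A →ₗ[ℂ] A →ₗ⋆[ℂ] (E →ₗ[ℂ] E) :=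
  LinearMap.mk₂'ₛₗ (RingHom.id ℂ) (starRingEnd ℂ)
    (fun ψ φ => LinearMap.adjoint R ∘ₗ TensorProduct.mk ℂ A B ψ ∘ₗ bra φ ∘ₗ R)
    (fun _ _ _ => by simp only [map_add, LinearMap.add_comp, LinearMap.comp_add])
    (fun _ _ _ => by
      simp only [map_smul, LinearMap.smul_comp, LinearMap.comp_smul, RingHom.id_apply])
    (fun _ _ _ => by simp only [map_add, LinearMap.add_comp, LinearMap.comp_add])
    (fun _ _ _ => by simp only [map_smulₛₗ, LinearMap.smul_comp, LinearMap.comp_smul])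

lemma sliceGram_eq (R : E →ₗ[ℂ] A ⊗[ℂ] B) (ψ φ : A) :
    sliceGram R ψ φ = LinearMap.adjoint (bra ψ ∘ₗ R) ∘ₗ (bra φ ∘ₗ R) := by
  rw [LinearMap.adjoint_comp, adjoint_bra]
  rfl

lemma inner_sliceGram (R : E →ₗ[ℂ] A ⊗[ℂ] B) (ψ φ : A) (x y : E) :
    inner ℂ x (sliceGram R ψ φ y) = inner ℂ (bra ψ (R x)) (bra φ (R y)) := by
  rw [sliceGram_eq, LinearMap.comp_apply, LinearMap.adjoint_inner_right]
  rfl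

lemma sliceGram_eq_zero_iff (R : E →ₗ[ℂ] A ⊗[ℂ] B) (ψ φ : A) :
    sliceGram R ψ φ = 0 ↔ ∀ x y, inner ℂ (bra ψ (R x)) (bra φ (R y)) = 0 := by
  refine ⟨fun h x y => ?_, fun h => LinearMap.ext fun y => ext_inner_left ℂ fun x => ?_⟩
  · rw [← inner_sliceGram, h, LinearMap.zero_apply, inner_zero_right]
  · rw [inner_sliceGram, h, LinearMap.zero_apply, inner_zero_right]

/-- `R` is isotropic if its slices at `ψ` and `φ` are related only through `⟨φ|ψ⟩`. This is the form
that maximal entanglement of `R R†` takes. -/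
def IsIsotropic (R : E →ₗ[ℂ] A ⊗[ℂ] B) : Prop :=
  ∃ G : E →ₗ[ℂ] E, ∀ ψ φ, sliceGram R ψ φ = inner ℂ φ ψ • G

end SliceGram

section Schmidt

variable {A B : Type*} [NormedAddCommGroup A] [InnerProductSpace ℂ A] [FiniteDimensional ℂ A]
  [NormedAddCommGroup B] [InnerProductSpace ℂ B] [FiniteDimensional ℂ B]

/-- The reduced operator `tr_B |v⟩⟨v|` of Alice: the Gram operator of the slices of `v`. -/
def reducedOp (v : A ⊗[ℂ] B) : A →ₗ[ℂ] A :=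
  ((LinearMap.adjoint (𝕜 := ℂ) (E := A) (F := A ⊗[ℂ] B)).toLinearMap ∘ₛₗ
    (TensorProduct.mk ℂ A B).flip).flip v ∘ₛₗ bra.flip v

lemma inner_reducedOp (v : A ⊗[ℂ] B) (ψ φ : A) :
    inner ℂ ψ (reducedOp v φ) = inner ℂ (bra φ v) (bra ψ v) := by
  rw [inner_bra]
  exact LinearMap.adjoint_inner_right ((TensorProduct.mk ℂ A B).flip (bra φ v)) ψ v

lemma isPositive_reducedOp (v : A ⊗[ℂ] B) : (reducedOp v).IsPositive := by
  refine ⟨fun ψ φ => ?_, fun ψ => ?_⟩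
  · rw [inner_reducedOp, ← inner_conj_symm, inner_reducedOp, inner_conj_symm]
  · rw [← inner_conj_symm, inner_reducedOp, inner_conj_symm]
    exact inner_self_nonneg

lemma exists_schmidtBasis (v : A ⊗[ℂ] B) :
    ∃ h : OrthonormalBasis (Fin (Module.finrank ℂ A)) ℂ A,
      (∀ i, reducedOp v (h i) = ((‖bra (h i) v‖ ^ 2 : ℝ) : ℂ) • h i) ∧
      ∀ i j, i ≠ j → inner ℂ (bra (h i) v) (bra (h j) v) = 0 := by
  obtain ⟨h, μ, -, hμ⟩ := exists_eigenbasis (isPositive_reducedOp v)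
  have key : ∀ i j, inner ℂ (bra (h i) v) (bra (h j) v) = if j = i then (μ i : ℂ) else 0 := by
    intro i j
    rw [← inner_reducedOp, hμ, inner_smul_right, h.inner_eq_ite, mul_ite, mul_one, mul_zero]
  refine ⟨h, fun i => ?_, fun i j hij => by rw [key, if_neg hij.symm]⟩
  have := key i i
  rw [if_pos rfl, inner_self_eq_ofReal] at this
  rw [hμ, ← this]

end Schmidt

section Separable

variable {E F G ι : Type*} [NormedAddCommGroup E] [InnerProductSpace ℂ E] [FiniteDimensional ℂ E]
  [NormedAddCommGroup F] [InnerProductSpace ℂ F] [FiniteDimensional ℂ F]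
  [NormedAddCommGroup G] [InnerProductSpace ℂ G] [FiniteDimensional ℂ G] [Fintype ι]

lemma sum_sum_adjoint_comp {κ : ι → Type*} [∀ i, Fintype (κ i)] {K : ι → E →ₗ[ℂ] F}
    (hK : ∑ i, LinearMap.adjoint (K i) ∘ₗ K i = LinearMap.id) {M : ∀ i, κ i → F →ₗ[ℂ] G}
    (hM : ∀ i, ∑ j, LinearMap.adjoint (M i j) ∘ₗ M i j = LinearMap.id) :
    ∑ i, ∑ j, LinearMap.adjoint (M i j ∘ₗ K i) ∘ₗ (M i j ∘ₗ K i) = LinearMap.id := by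
  rw [← hK]
  refine Finset.sum_congr rfl fun i _ => LinearMap.ext fun v => ?_
  have hv := congr($(hM i) (K i v))
  simp only [LinearMap.sum_apply, LinearMap.adjoint_comp, LinearMap.comp_apply,
    LinearMap.id_apply] at hv ⊢
  rw [← map_sum, hv]

lemma IsKraus.rTensor {n : ℕ} {K : Fin n → E →ₗ[ℂ] F} (hK : IsKraus K) :
    ∑ i, LinearMap.adjoint ((K i).rTensor G) ∘ₗ (K i).rTensor G = LinearMap.id := by
  simp_rw [LinearMap.adjoint_rTensor, ← LinearMap.rTensor_comp, ← LinearMap.coe_rTensorHom]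
  rw [← map_sum, hK, LinearMap.coe_rTensorHom, LinearMap.rTensor_id]

lemma IsKraus.lTensor {n : ℕ} {K : Fin n → E →ₗ[ℂ] F} (hK : IsKraus K) :
    ∑ i, LinearMap.adjoint ((K i).lTensor G) ∘ₗ (K i).lTensor G = LinearMap.id := by
  simp_rw [LinearMap.adjoint_lTensor, ← LinearMap.lTensor_comp, ← LinearMap.coe_lTensorHom]
  rw [← map_sum, hK, LinearMap.coe_lTensorHom, LinearMap.lTensor_id]

variable {A A' B B' : Type*} [NormedAddCommGroup A] [InnerProductSpace ℂ A]
  [FiniteDimensional ℂ A] [NormedAddCommGroup B] [InnerProductSpace ℂ B] [FiniteDimensional ℂ B]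
  [NormedAddCommGroup A'] [InnerProductSpace ℂ A'] [FiniteDimensional ℂ A']
  [NormedAddCommGroup B'] [InnerProductSpace ℂ B'] [FiniteDimensional ℂ B']

/-- A separable map: one with a complete set of Kraus operators that are product operators. -/
def IsSeparable (Λ : (A ⊗[ℂ] B →ₗ[ℂ] A ⊗[ℂ] B) →ₗ[ℂ] (A' ⊗[ℂ] B' →ₗ[ℂ] A' ⊗[ℂ] B')) : Prop :=
  ∃ (κ : Type) (_ : Fintype κ) (f : κ → A →ₗ[ℂ] A') (g : κ → B →ₗ[ℂ] B'),
    (∀ T, Λ T = ∑ i, conjBy (TensorProduct.map (f i) (g i)) T) ∧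
    ∑ i, LinearMap.adjoint (TensorProduct.map (f i) (g i)) ∘ₗ TensorProduct.map (f i) (g i) =
      LinearMap.id

end Separable

lemma IsLOCC.isSeparable {A A' : Type u} {B B' : Type v}
    [NormedAddCommGroup A] [InnerProductSpace ℂ A] [FiniteDimensional ℂ A]
    [NormedAddCommGroup B] [InnerProductSpace ℂ B] [FiniteDimensional ℂ B]
    [NormedAddCommGroup A'] [InnerProductSpace ℂ A'] [FiniteDimensional ℂ A']
    [NormedAddCommGroup B'] [InnerProductSpace ℂ B'] [FiniteDimensional ℂ B']
    {Λ : (A ⊗[ℂ] B →ₗ[ℂ] A ⊗[ℂ] B) →ₗ[ℂ] (A' ⊗[ℂ] B' →ₗ[ℂ] A' ⊗[ℂ] B')} (hΛ : IsLOCC Λ) :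
    IsSeparable Λ := by
  induction hΛ with
  | nil =>
    exact ⟨Unit, inferInstance, fun _ => LinearMap.id, fun _ => LinearMap.id,
      fun T => by simp [conjBy], by simp⟩
  | alice K hK Λ _ ih =>
    choose κ _ f g hfg hid using ih
    refine ⟨Σ i, κ i, inferInstance, fun p => f p.1 p.2 ∘ₗ K p.1, fun p => g p.1 p.2,
      fun T => ?_, ?_⟩
    · simp only [LinearMap.sum_apply, LinearMap.comp_apply, hfg, Fintype.sum_sigma, conjBy_conjBy,
        LinearMap.map_comp_rTensor]
    · simp only [Fintype.sum_sigma, ← LinearMap.map_comp_rTensor]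
      exact sum_sum_adjoint_comp hK.rTensor hid
  | bob K hK Λ _ ih =>
    choose κ _ f g hfg hid using ih
    refine ⟨Σ i, κ i, inferInstance, fun p => f p.1 p.2, fun p => g p.1 p.2 ∘ₗ K p.1,
      fun T => ?_, ?_⟩
    · simp only [LinearMap.sum_apply, LinearMap.comp_apply, hfg, Fintype.sum_sigma, conjBy_conjBy,
        LinearMap.map_comp_lTensor]
    · simp only [Fintype.sum_sigma, ← LinearMap.map_comp_lTensor]
      exact sum_sum_adjoint_comp hK.lTensor hid

section Fidelity

variable {A A' B B' ι κ : Type*} [NormedAddCommGroup A] [InnerProductSpace ℂ A]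
  [FiniteDimensional ℂ A] [NormedAddCommGroup B] [InnerProductSpace ℂ B] [FiniteDimensional ℂ B]
  [NormedAddCommGroup A'] [InnerProductSpace ℂ A'] [FiniteDimensional ℂ A']
  [NormedAddCommGroup B'] [InnerProductSpace ℂ B'] [FiniteDimensional ℂ B'] [Fintype ι] [Fintype κ]

/-- The hypothesis `hΦ` says that `Φ` is maximally entangled, with `‖Φ‖ ^ 2 = dim A'`. -/
lemma norm_inner_map_le (h : OrthonormalBasis ι ℂ A) {Φ : A' ⊗[ℂ] B'} (hΦ : ∀ ψ, ‖bra ψ Φ‖ = ‖ψ‖)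
    (f : A →ₗ[ℂ] A') (g : B →ₗ[ℂ] B') (v : A ⊗[ℂ] B) :
    ‖(inner ℂ Φ (TensorProduct.map f g v) : ℂ)‖ ≤ ∑ j, ‖f (h j)‖ * ‖g (bra (h j) v)‖ := by
  conv_lhs => rw [← sum_tmul_bra h v]
  rw [map_sum, inner_sum]
  refine (norm_sum_le _ _).trans (Finset.sum_le_sum fun j _ => ?_)
  rw [TensorProduct.map_tmul, norm_inner_symm, ← inner_bra, norm_inner_symm, ← hΦ]
  exact norm_inner_le_norm _ _

lemma sum_norm_inner_sq_le (h : OrthonormalBasis ι ℂ A) {Φ : A' ⊗[ℂ] B'}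
    (hΦ : ∀ ψ, ‖bra ψ Φ‖ = ‖ψ‖) {f : κ → A →ₗ[ℂ] A'} {g : κ → B →ₗ[ℂ] B'}
    (hfg : ∑ i, LinearMap.adjoint (TensorProduct.map (f i) (g i)) ∘ₗ
      TensorProduct.map (f i) (g i) = LinearMap.id) (v : A ⊗[ℂ] B) :
    ∑ i, ‖(inner ℂ Φ (TensorProduct.map (f i) (g i) v) : ℂ)‖ ^ 2 ≤
      (∑ j, ‖bra (h j) v‖) ^ 2 := by
  have hprod : ∀ j k, ∑ i, (‖f i (h j)‖ * ‖g i (bra (h k) v)‖) ^ 2 = ‖bra (h k) v‖ ^ 2 := by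
    intro j k
    simpa using sum_norm_sq_of_sum_adjoint_comp hfg (h j ⊗ₜ[ℂ] bra (h k) v)
  have hcs : ∀ j k, ∑ i, (‖f i (h j)‖ * ‖g i (bra (h k) v)‖) * (‖f i (h k)‖ * ‖g i (bra (h j) v)‖) ≤
      ‖bra (h j) v‖ * ‖bra (h k) v‖ := by
    intro j k
    refine (Real.sum_mul_le_sqrt_mul_sqrt _ _ _).trans_eq ?_
    rw [hprod, hprod, Real.sqrt_sq (norm_nonneg _), Real.sqrt_sq (norm_nonneg _), mul_comm]
  calc _ ≤ ∑ i, (∑ j, ‖f i (h j)‖ * ‖g i (bra (h j) v)‖) ^ 2 :=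
        Finset.sum_le_sum fun i _ =>
          pow_le_pow_left₀ (norm_nonneg _) (norm_inner_map_le h hΦ (f i) (g i) v) 2
    _ = ∑ j, ∑ k, ∑ i,
          (‖f i (h j)‖ * ‖g i (bra (h k) v)‖) * (‖f i (h k)‖ * ‖g i (bra (h j) v)‖) := by
        simp_rw [sq, Finset.sum_mul_sum]
        rw [Finset.sum_comm]
        refine Finset.sum_congr rfl fun j _ => ?_
        rw [Finset.sum_comm]
        refine Finset.sum_congr rfl fun k _ => Finset.sum_congr rfl fun i _ => by ring
    _ ≤ ∑ j, ∑ k, ‖bra (h j) v‖ * ‖bra (h k) v‖ :=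
        Finset.sum_le_sum fun j _ => Finset.sum_le_sum fun k _ => hcs j k
    _ = (∑ j, ‖bra (h j) v‖) ^ 2 := by rw [sq, Finset.sum_mul_sum]

lemma IsSeparable.inner_apply_ketBra_le
    {Λ : (A ⊗[ℂ] B →ₗ[ℂ] A ⊗[ℂ] B) →ₗ[ℂ] (A' ⊗[ℂ] B' →ₗ[ℂ] A' ⊗[ℂ] B')} (hΛ : IsSeparable Λ)
    (h : OrthonormalBasis ι ℂ A) {Φ : A' ⊗[ℂ] B'} (hΦ : ∀ ψ, ‖bra ψ Φ‖ = ‖ψ‖) (v : A ⊗[ℂ] B) :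
    (inner ℂ Φ (Λ (ketBra v) Φ)).re ≤ (∑ j, ‖bra (h j) v‖) ^ 2 := by
  obtain ⟨κ, _, f, g, hfg, hid⟩ := hΛ
  simp_rw [hfg, conjBy_ketBra, LinearMap.sum_apply, inner_sum, Complex.re_sum,
    inner_ketBra_apply_self, Complex.ofReal_re]
  exact sum_norm_inner_sq_le h hΦ hid v

lemma exists_norm_bra_eq (hAB : Module.finrank ℂ A ≤ Module.finrank ℂ B) :
    ∃ Φ : A ⊗[ℂ] B, ∀ ψ, ‖bra ψ Φ‖ = ‖ψ‖ := by
  let h := stdOrthonormalBasis ℂ A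
  have hb : Orthonormal ℂ fun i => stdOrthonormalBasis ℂ B (Fin.castLE hAB i) :=
    (stdOrthonormalBasis ℂ B).orthonormal.comp _ (Fin.castLE_injective hAB)
  refine ⟨∑ i, h i ⊗ₜ[ℂ] stdOrthonormalBasis ℂ B (Fin.castLE hAB i), fun ψ => ?_⟩
  rw [← sq_eq_sq₀ (norm_nonneg _) (norm_nonneg _), ← h.sum_sq_norm_inner_left ψ, map_sum]
  simp_rw [bra_tmul]
  have key := hb.inner_sum (fun i => inner ℂ ψ (h i)) (fun i => inner ℂ ψ (h i)) Finset.univ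
  simp_rw [inner_self_eq_norm_sq_to_K, RCLike.conj_mul] at key
  exact_mod_cast key

end Fidelity

section Isotropic

variable {A : Type u} {B : Type v} {E : Type*} [NormedAddCommGroup A] [InnerProductSpace ℂ A]
  [FiniteDimensional ℂ A] [NormedAddCommGroup B] [InnerProductSpace ℂ B] [FiniteDimensional ℂ B]
  [NormedAddCommGroup E] [InnerProductSpace ℂ E] [FiniteDimensional ℂ E]

lemma eq_of_card_mul_sum_sq_le {ι : Type*} [Fintype ι] {s : ι → ℝ}
    (h : (Fintype.card ι : ℝ) * ∑ j, s j ^ 2 ≤ (∑ j, s j) ^ 2) (i j : ι) : s i = s j := by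
  have hsum : ∑ i, ∑ j, (s i - s j) ^ 2 =
      2 * ((Fintype.card ι : ℝ) * ∑ j, s j ^ 2) - 2 * (∑ j, s j) ^ 2 := by
    simp_rw [sub_sq, Finset.sum_add_distrib, Finset.sum_sub_distrib, mul_assoc, ← Finset.mul_sum,
      ← Finset.sum_mul, Finset.sum_const, Finset.card_univ, nsmul_eq_mul, ← Finset.mul_sum]
    ring
  have hzero : ∑ i, ∑ j, (s i - s j) ^ 2 = 0 := le_antisymm (by linarith) (by positivity)
  rw [Finset.sum_eq_zero_iff_of_nonneg fun i _ => by positivity] at hzero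
  have hi := hzero i (Finset.mem_univ i)
  rw [Finset.sum_eq_zero_iff_of_nonneg fun j _ => by positivity] at hi
  exact sub_eq_zero.1 (pow_eq_zero_iff two_ne_zero |>.1 (hi j (Finset.mem_univ j)))

lemma card_mul_norm_sq_eq {ι : Type*} [Fintype ι] (h : OrthonormalBasis ι ℂ A) {v : A ⊗[ℂ] B}
    (hv : (Fintype.card ι : ℝ) * ‖v‖ ^ 2 ≤ (∑ j, ‖bra (h j) v‖) ^ 2) (i : ι) :
    ‖v‖ ^ 2 = Fintype.card ι * ‖bra (h i) v‖ ^ 2 := by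
  rw [norm_sq_eq_sum_bra h] at hv ⊢
  simp_rw [eq_of_card_mul_sum_sq_le hv _ i, Finset.sum_const, Finset.card_univ, nsmul_eq_mul]

lemma reducedOp_eq_smul_id {v : A ⊗[ℂ] B}
    (hv : ∀ h : OrthonormalBasis (Fin (Module.finrank ℂ A)) ℂ A,
      Module.finrank ℂ A * ‖v‖ ^ 2 ≤ (∑ j, ‖bra (h j) v‖) ^ 2) :
    reducedOp v = ((‖v‖ ^ 2 / Module.finrank ℂ A : ℝ) : ℂ) • LinearMap.id := by
  obtain ⟨h, hred, -⟩ := exists_schmidtBasis v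
  refine h.toBasis.ext fun i => ?_
  have hpos : (0 : ℝ) < Module.finrank ℂ A := by exact_mod_cast i.pos
  have hnorm := card_mul_norm_sq_eq h (by simpa using hv h) i
  rw [Fintype.card_fin] at hnorm
  rw [h.coe_toBasis, hred, hnorm, mul_div_cancel_left₀ _ hpos.ne', LinearMap.smul_apply,
    LinearMap.id_apply]

lemma isIsotropic_of_reducedOp {R : E →ₗ[ℂ] A ⊗[ℂ] B} (c : ℝ)
    (hR : ∀ e, reducedOp (R e) = ((‖R e‖ ^ 2 / c : ℝ) : ℂ) • LinearMap.id) : IsIsotropic R := by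
  refine ⟨(c⁻¹ : ℂ) • (LinearMap.adjoint R ∘ₗ R), fun ψ φ => (ext_inner_map _ _).1 fun e => ?_⟩
  rw [← inner_conj_symm, inner_sliceGram, ← inner_reducedOp, hR,
    ← inner_conj_symm ((inner ℂ φ ψ • _ : E →ₗ[ℂ] E) e) e]
  congr 1
  simp only [LinearMap.smul_apply, LinearMap.id_apply, inner_smul_right, LinearMap.comp_apply,
    LinearMap.adjoint_inner_right]
  rw [inner_self_eq_ofReal (R e)]
  push_cast
  ring

lemma IsSubnormalizedMES.exists_isSeparable {ι : Type*} [Fintype ι] {R : E →ₗ[ℂ] A ⊗[ℂ] B}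
    (hR : IsSubnormalizedMES (R ∘ₗ LinearMap.adjoint R)) (b : OrthonormalBasis ι ℂ E)
    {Φ : A ⊗[ℂ] B} (hΦ : Φ ≠ 0) :
    ∃ Λ : (A ⊗[ℂ] B →ₗ[ℂ] A ⊗[ℂ] B) →ₗ[ℂ] (A ⊗[ℂ] B →ₗ[ℂ] A ⊗[ℂ] B), IsSeparable Λ ∧
      ∑ k, (inner ℂ Φ (Λ (ketBra (R (b k))) Φ)).re = ∑ k, ‖Φ‖ ^ 2 * ‖R (b k)‖ ^ 2 := by
  obtain ⟨q, ρ, -, -, hρ, hq⟩ := hR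
  obtain ⟨Λ, hΛ, hΛρ⟩ := hρ.2 _ (isState_smul_ketBra hΦ)
  have htrace : ∑ k, ‖R (b k)‖ ^ 2 = q := by
    apply Complex.ofReal_injective
    rw [← trace_comp_adjoint b R, hq, map_smul, hρ.1.2, smul_eq_mul, mul_one]
  have hΛR : ∑ k, Λ (ketBra (R (b k))) = ((q * (‖Φ‖ ^ 2)⁻¹ : ℝ) : ℂ) • ketBra Φ := by
    rw [← map_sum, ← comp_adjoint_eq_sum_ketBra, hq, map_smul, hΛρ, smul_smul, Complex.ofReal_mul]
  refine ⟨Λ, hΛ.isSeparable, ?_⟩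
  calc ∑ k, (inner ℂ Φ (Λ (ketBra (R (b k))) Φ)).re
      = (inner ℂ Φ ((∑ k, Λ (ketBra (R (b k)))) Φ)).re := by
        rw [LinearMap.sum_apply, inner_sum, Complex.re_sum]
    _ = q * (‖Φ‖ ^ 2)⁻¹ * ‖(inner ℂ Φ Φ : ℂ)‖ ^ 2 := by
        rw [hΛR, LinearMap.smul_apply, inner_smul_right, inner_ketBra_apply_self,
          ← Complex.ofReal_mul, Complex.ofReal_re]
    _ = ∑ k, ‖Φ‖ ^ 2 * ‖R (b k)‖ ^ 2 := by
        rw [← Finset.mul_sum, htrace, inner_self_eq_norm_sq_to_K (𝕜 := ℂ) Φ, norm_pow,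
          RCLike.norm_ofReal, abs_norm]
        have := norm_ne_zero_iff.2 hΦ
        field_simp

lemma IsSubnormalizedMES.finrank_mul_norm_sq_le {R : E →ₗ[ℂ] A ⊗[ℂ] B}
    (hR : IsSubnormalizedMES (R ∘ₗ LinearMap.adjoint R))
    (hAB : Module.finrank ℂ A ≤ Module.finrank ℂ B)
    (h : OrthonormalBasis (Fin (Module.finrank ℂ A)) ℂ A) (e : E) :
    Module.finrank ℂ A * ‖R e‖ ^ 2 ≤ (∑ j, ‖bra (h j) (R e)‖) ^ 2 := by
  obtain ⟨Φ, hΦ⟩ := exists_norm_bra_eq hAB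
  have hnormΦ : ‖Φ‖ ^ 2 = Module.finrank ℂ A := by
    simp [norm_sq_eq_sum_bra h, hΦ, h.norm_eq_one]
  rcases eq_or_ne Φ 0 with rfl | hΦ0
  · rw [← hnormΦ, norm_zero, zero_pow two_ne_zero, zero_mul]
    positivity
  rcases eq_or_ne e 0 with rfl | he
  · simp
  obtain ⟨b, i, hbi⟩ := exists_orthonormalBasis_smul_eq he
  obtain ⟨Λ, hΛ, hsum⟩ := hR.exists_isSeparable b hΦ0
  rw [hnormΦ] at hsum
  have hle : ∀ k, (inner ℂ Φ (Λ (ketBra (R (b k))) Φ)).re ≤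
      Module.finrank ℂ A * ‖R (b k)‖ ^ 2 := fun k =>
    (hΛ.inner_apply_ketBra_le h hΦ (R (b k))).trans <| by
      simpa [norm_sq_eq_sum_bra h] using
        sq_sum_le_card_mul_sum_sq (s := Finset.univ) (f := fun j => ‖bra (h j) (R (b k))‖)
  have hi : Module.finrank ℂ A * ‖R (b i)‖ ^ 2 ≤ (∑ j, ‖bra (h j) (R (b i))‖) ^ 2 := by
    rw [← (Finset.sum_eq_sum_iff_of_le fun k _ => hle k).1 hsum i (Finset.mem_univ i)]
    exact hΛ.inner_apply_ketBra_le h hΦ (R (b i))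
  rw [← hbi]
  simp_rw [map_smul, norm_smul, ← Finset.mul_sum, mul_pow]
  rw [mul_left_comm]
  exact mul_le_mul_of_nonneg_left hi (sq_nonneg _)

lemma IsSubnormalizedMES.isIsotropic {R : E →ₗ[ℂ] A ⊗[ℂ] B}
    (hR : IsSubnormalizedMES (R ∘ₗ LinearMap.adjoint R))
    (hAB : Module.finrank ℂ A ≤ Module.finrank ℂ B) : IsIsotropic R :=
  isIsotropic_of_reducedOp (Module.finrank ℂ A) fun e =>
    reducedOp_eq_smul_id fun h => hR.finrank_mul_norm_sq_le hAB h e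

end Isotropic

section PartialTrace

variable {A B ι : Type*} [NormedAddCommGroup A] [InnerProductSpace ℂ A] [FiniteDimensional ℂ A]
  [NormedAddCommGroup B] [InnerProductSpace ℂ B] [FiniteDimensional ℂ B] [Fintype ι]

lemma condOp_rankOne (ψ : A) (u w : A ⊗[ℂ] B) :
    condOp ψ (InnerProductSpace.rankOne ℂ u w).toLinearMap =
      (InnerProductSpace.rankOne ℂ (bra ψ u) (bra ψ w)).toLinearMap := by
  ext b
  change bra ψ (inner ℂ w (ψ ⊗ₜ[ℂ] b) • u) = inner ℂ (bra ψ w) b • bra ψ u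
  rw [map_smul, ← inner_conj_symm w, ← inner_bra, inner_conj_symm]

lemma partialTraceA_eq (h : OrthonormalBasis ι ℂ A) (T : A ⊗[ℂ] B →ₗ[ℂ] A ⊗[ℂ] B) :
    partialTraceA T = ∑ i, condOp (h i) T := by
  refine LinearMap.ext fun w => ext_inner_left ℂ fun z => ?_
  trans LinearMap.trace ℂ A (LinearMap.adjoint ((TensorProduct.mk ℂ A B).flip z) ∘ₗ T ∘ₗ
    (TensorProduct.mk ℂ A B).flip w)
  · rw [LinearMap.trace_eq_sum_inner _ (stdOrthonormalBasis ℂ A)]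
    simp [partialTraceA, LinearMap.sum_apply, inner_sum, condOp, LinearMap.adjoint_inner_right]
  · rw [LinearMap.trace_eq_sum_inner _ h]
    simp [LinearMap.sum_apply, inner_sum, condOp, LinearMap.adjoint_inner_right]

lemma partialTraceA_rankOne_apply (h : OrthonormalBasis ι ℂ A) (u w : A ⊗[ℂ] B) (b : B) :
    partialTraceA (InnerProductSpace.rankOne ℂ u w).toLinearMap b =
      ∑ i, inner ℂ (bra (h i) w) b • bra (h i) u := by
  simp_rw [partialTraceA_eq h, condOp_rankOne, LinearMap.sum_apply]
  rfl

lemma inner_partialTraceA_rankOne (h : OrthonormalBasis ι ℂ A) (u w : A ⊗[ℂ] B) (b c : B) :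
    inner ℂ b (partialTraceA (InnerProductSpace.rankOne ℂ u w).toLinearMap c) =
      ∑ i, inner ℂ (bra (h i) w) c * inner ℂ b (bra (h i) u) := by
  simp_rw [partialTraceA_rankOne_apply h, inner_sum, inner_smul_right]

end PartialTrace

section MaxEntangledFamily

variable {A B J : Type*} [NormedAddCommGroup A] [InnerProductSpace ℂ A] [FiniteDimensional ℂ A]
  [NormedAddCommGroup B] [InnerProductSpace ℂ B] [FiniteDimensional ℂ B] [DecidableEq J]

/-- Maximally entangled vectors `Φ j`, normalised so that their slices at unit vectors are unit
vectors, which live on mutually orthogonal subspaces of Bob. -/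
def IsMaxEntangledFamily (Φ : J → A ⊗[ℂ] B) : Prop :=
  ∀ j k ψ φ, inner ℂ (bra ψ (Φ j)) (bra φ (Φ k)) = if j = k then inner ℂ φ ψ else (0 : ℂ)

namespace IsMaxEntangledFamily

variable {Φ : J → A ⊗[ℂ] B} (hΦ : IsMaxEntangledFamily Φ)
include hΦ

lemma norm_sq_eq (j : J) : ‖Φ j‖ ^ 2 = Module.finrank ℂ A := by
  have h := stdOrthonormalBasis ℂ A
  have hslice : ∀ i, ‖bra (h i) (Φ j)‖ ^ 2 = 1 := fun i => by
    have := hΦ j j (h i) (h i)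
    rw [if_pos rfl, h.inner_eq_one, inner_self_eq_ofReal] at this
    exact_mod_cast this
  simp [norm_sq_eq_sum_bra h, hslice]

lemma partialTraceA_rankOne_bra (S : A →ₗ[ℂ] A) (u : A ⊗[ℂ] B) (j k : J) (ψ : A) :
    partialTraceA (InnerProductSpace.rankOne ℂ u (S.rTensor B (Φ j))).toLinearMap (bra ψ (Φ k)) =
      if j = k then bra (S ψ) u else 0 := by
  have h := stdOrthonormalBasis ℂ A
  simp_rw [partialTraceA_rankOne_apply h, bra_rTensor, hΦ j k, LinearMap.adjoint_inner_right]
  split_ifs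
  · conv_rhs => rw [← h.sum_repr' (S ψ)]
    simp [LinearMap.sum_apply]
  · simp

lemma map_partialTraceA_rankOne (S : A ≃ₗᵢ[ℂ] A) (u : A ⊗[ℂ] B) (j k : J) :
    TensorProduct.map S.toLinearMap (partialTraceA
      (InnerProductSpace.rankOne ℂ u (S.toLinearMap.rTensor B (Φ j))).toLinearMap) (Φ k) =
      if j = k then u else 0 := by
  refine ext_bra (stdOrthonormalBasis ℂ A) fun i => ?_
  rw [bra_map, hΦ.partialTraceA_rankOne_bra, S.adjoint_toLinearMap_eq_symm, apply_ite (bra _),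
    map_zero]
  simp

variable [Fintype J]

lemma sum_partialTraceA_ketBra_bra (k : J) (ψ : A) :
    (∑ j, partialTraceA (ketBra (Φ j))) (bra ψ (Φ k)) = bra ψ (Φ k) := by
  have : ∀ j, partialTraceA (ketBra (Φ j)) (bra ψ (Φ k)) = if j = k then bra ψ (Φ j) else 0 :=
    fun j => by simpa using! hΦ.partialTraceA_rankOne_bra LinearMap.id (Φ j) j k ψ
  simp [LinearMap.sum_apply, this]

lemma isSymmetricProjection_sum_partialTraceA_ketBra :
    (∑ j, partialTraceA (ketBra (Φ j))).IsSymmetricProjection := by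
  have h := stdOrthonormalBasis ℂ A
  refine ⟨LinearMap.ext fun b => ?_, fun b c => ?_⟩
  · have hb : (∑ j, partialTraceA (ketBra (Φ j))) b =
        ∑ j, ∑ i, inner ℂ (bra (h i) (Φ j)) b • bra (h i) (Φ j) := by
      rw [LinearMap.sum_apply]
      exact Finset.sum_congr rfl fun j _ => partialTraceA_rankOne_apply h _ _ b
    rw [Module.End.mul_apply, hb]
    simp_rw [map_sum, map_smul, hΦ.sum_partialTraceA_ketBra_bra]
  · simp_rw [LinearMap.sum_apply, sum_inner, inner_sum]
    refine Finset.sum_congr rfl fun j _ => ?_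
    rw [← inner_conj_symm]
    simp_rw [ketBra, inner_partialTraceA_rankOne h, map_sum, map_mul, inner_conj_symm]
    exact Finset.sum_congr rfl fun i _ => mul_comm _ _

end IsMaxEntangledFamily

end MaxEntangledFamily

section Protocol

variable {A B ι : Type*} [NormedAddCommGroup A] [InnerProductSpace ℂ A] [FiniteDimensional ℂ A]
  [NormedAddCommGroup B] [InnerProductSpace ℂ B] [FiniteDimensional ℂ B] [Fintype ι] [AddGroup ι]

/-- The unitary `h i ↦ h (i - s)` that permutes an orthonormal basis indexed by a group. -/
def shift (h : OrthonormalBasis ι ℂ A) (s : ι) : A ≃ₗᵢ[ℂ] A :=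
  h.equiv h (Equiv.subRight s)

lemma bra_shift_rTensor (h : OrthonormalBasis ι ℂ A) (s i : ι) (v : A ⊗[ℂ] B) :
    bra (h i) ((shift h s).toLinearMap.rTensor B v) = bra (h (i + s)) v := by
  rw [bra_rTensor, LinearIsometryEquiv.adjoint_toLinearMap_eq_symm]
  simp [shift]

/-- Bob's Kraus operator `tr_A |u⟩⟨(V ⊗ 1) w|`, where `V = shift h s`. For `w` maximally entangled,
Alice applying `V` after it turns `w` into `u`. -/
def steer (h : OrthonormalBasis ι ℂ A) (u w : A ⊗[ℂ] B) (s : ι) : B →ₗ[ℂ] B :=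
  partialTraceA
    (InnerProductSpace.rankOne ℂ u ((shift h s).toLinearMap.rTensor B w)).toLinearMap

lemma IsMaxEntangledFamily.map_shift_steer {J : Type*} [DecidableEq J] {Φ : J → A ⊗[ℂ] B}
    (hΦ : IsMaxEntangledFamily Φ) (h : OrthonormalBasis ι ℂ A) (u : A ⊗[ℂ] B) (s : ι)
    (j k : J) :
    TensorProduct.map (shift h s).toLinearMap (steer h u (Φ j) s) (Φ k) =
      if j = k then u else 0 :=
  hΦ.map_partialTraceA_rankOne _ u j k

lemma sum_adjoint_comp_steer (h : OrthonormalBasis ι ℂ A) {u : A ⊗[ℂ] B}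
    (hu : ∀ i j, i ≠ j → inner ℂ (bra (h i) u) (bra (h j) u) = (0 : ℂ)) (w : A ⊗[ℂ] B) :
    ∑ s, LinearMap.adjoint (steer h u w s) ∘ₗ steer h u w s =
      ((‖u‖ ^ 2 : ℝ) : ℂ) • partialTraceA (ketBra w) := by
  have hgram : ∀ x y : ι → ℂ, inner ℂ (∑ i, x i • bra (h i) u) (∑ i, y i • bra (h i) u) =
      ∑ i, ((‖bra (h i) u‖ ^ 2 : ℝ) : ℂ) * (y i * starRingEnd ℂ (x i)) := by
    intro x y
    simp_rw [sum_inner, inner_sum, inner_smul_left, inner_smul_right]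
    refine Finset.sum_congr rfl fun i _ => ?_
    rw [Finset.sum_eq_single i (fun j _ hij => by rw [hu i j hij.symm, mul_zero, mul_zero])
      (fun hi => (hi (Finset.mem_univ i)).elim), inner_self_eq_ofReal]
    ring
  refine LinearMap.ext fun b => ext_inner_left ℂ fun c => ?_
  simp_rw [LinearMap.sum_apply, inner_sum, LinearMap.comp_apply, LinearMap.adjoint_inner_right,
    steer, partialTraceA_rankOne_apply h, bra_shift_rTensor, hgram, inner_conj_symm]
  rw [Finset.sum_comm, LinearMap.smul_apply, inner_smul_right, ketBra,
    inner_partialTraceA_rankOne h, norm_sq_eq_sum_bra h u, Complex.ofReal_sum, Finset.sum_mul]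
  refine Finset.sum_congr rfl fun i _ => ?_
  rw [← Finset.mul_sum]
  congr 1
  exact Equiv.sum_comp (Equiv.addLeft i) fun s => inner ℂ (bra (h s) w) b * inner ℂ c (bra (h s) w)

end Protocol

section LOCCProtocol

variable {A : Type u} {B : Type v} {E κ : Type*} [NormedAddCommGroup A] [InnerProductSpace ℂ A]
  [FiniteDimensional ℂ A] [NormedAddCommGroup B] [InnerProductSpace ℂ B] [FiniteDimensional ℂ B]
  [NormedAddCommGroup E] [InnerProductSpace ℂ E] [FiniteDimensional ℂ E] [Fintype κ]

lemma isLOCC_sum_conjBy_map {K : κ → B →ₗ[ℂ] B}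
    (hK : ∑ k, LinearMap.adjoint (K k) ∘ₗ K k = LinearMap.id) (U : κ → A ≃ₗᵢ[ℂ] A) :
    IsLOCC (∑ k, conjBy (TensorProduct.map (U k).toLinearMap (K k))) := by
  have hA : ∀ k, IsLOCC (conjBy ((U k).toLinearMap.rTensor B)) := fun k => by
    have hU : LinearMap.adjoint (U k).toLinearMap ∘ₗ (U k).toLinearMap = LinearMap.id := by
      rw [LinearIsometryEquiv.adjoint_toLinearMap_eq_symm]
      ext
      simp
    simpa using IsLOCC.alice (A' := A) (B' := B) (n := 1) (fun _ => (U k).toLinearMap)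
      (by simpa [IsKraus] using hU) (fun _ => LinearMap.id) fun _ => IsLOCC.nil
  have hcomp : ∀ k, conjBy (TensorProduct.map (U k).toLinearMap (K k)) =
      conjBy ((U k).toLinearMap.rTensor B) ∘ₗ conjBy ((K k).lTensor A) := fun k =>
    LinearMap.ext fun T => by
      rw [LinearMap.comp_apply, conjBy_conjBy, LinearMap.rTensor_comp_lTensor]
  let e := (Fintype.equivFin κ).symm
  simp_rw [hcomp]
  rw [← e.sum_comp]
  exact IsLOCC.bob (fun i => K (e i)) (by rw [IsKraus, ← hK, ← e.sum_comp]) _ fun i => hA (e i)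

lemma IsState.nontrivial_left {σ : A ⊗[ℂ] B →ₗ[ℂ] A ⊗[ℂ] B} (hσ : IsState σ) : Nontrivial A := by
  by_contra hA
  have := not_nontrivial_iff_subsingleton.1 hA
  have hzero : σ = 0 :=
    LinearMap.ext fun v => ext_bra (stdOrthonormalBasis ℂ A) fun i => by
      rw [Subsingleton.elim (stdOrthonormalBasis ℂ A i) 0, map_zero]
      rfl
  simpa [hzero] using hσ.2

lemma sum_sum_adjoint_comp_steer {J : Type*} {n r : ℕ} [Fintype J] [NeZero r]
    (h : Fin n → OrthonormalBasis (Fin r) ℂ A) {u : Fin n → A ⊗[ℂ] B} (hu : ∑ l, ‖u l‖ ^ 2 = 1)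
    (hh : ∀ l i j, i ≠ j → inner ℂ (bra (h l i) (u l)) (bra (h l j) (u l)) = (0 : ℂ))
    (Φ : J → A ⊗[ℂ] B) :
    ∑ p : Fin n × J × Fin r, LinearMap.adjoint (steer (h p.1) (u p.1) (Φ p.2.1) p.2.2) ∘ₗ
        steer (h p.1) (u p.1) (Φ p.2.1) p.2.2 = ∑ j, partialTraceA (ketBra (Φ j)) := by
  simp_rw [Fintype.sum_prod_type, sum_adjoint_comp_steer (h _) (hh _)]
  rw [Finset.sum_comm]
  simp_rw [← Finset.sum_smul, ← Complex.ofReal_sum, hu, Complex.ofReal_one, one_smul]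

lemma IsMaxEntangledFamily.exists_isLOCC {J : Type*} [Finite J] [DecidableEq J]
    {Φ : J → A ⊗[ℂ] B} (hΦ : IsMaxEntangledFamily Φ) {σ : A ⊗[ℂ] B →ₗ[ℂ] A ⊗[ℂ] B}
    (hσ : IsState σ) :
    ∃ Λ : (A ⊗[ℂ] B →ₗ[ℂ] A ⊗[ℂ] B) →ₗ[ℂ] (A ⊗[ℂ] B →ₗ[ℂ] A ⊗[ℂ] B), IsLOCC Λ ∧
      ∀ k, Λ (ketBra (Φ k)) = (Module.finrank ℂ A : ℂ) • σ := by
  have := Fintype.ofFinite J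
  have := hσ.nontrivial_left
  have : NeZero (Module.finrank ℂ A) := ⟨Module.finrank_pos.ne'⟩
  obtain ⟨n, u, hu⟩ := exists_eq_sum_ketBra hσ.1
  have hnorm : ∑ l, ‖u l‖ ^ 2 = 1 := by
    have := hσ.2
    simp_rw [hu, map_sum, trace_ketBra] at this
    exact_mod_cast this
  choose h hh using fun l => exists_schmidtBasis (u l)
  let κ := Fin n × J × Fin (Module.finrank ℂ A)
  let P : B →ₗ[ℂ] B := ∑ j, partialTraceA (ketBra (Φ j))
  let U : Option κ → A ≃ₗᵢ[ℂ] A := fun o =>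
    o.elim (LinearIsometryEquiv.refl ℂ A) fun p => shift (h p.1) p.2.2
  let K : Option κ → B →ₗ[ℂ] B := fun o =>
    o.elim (LinearMap.id - P) fun p => steer (h p.1) (u p.1) (Φ p.2.1) p.2.2
  have hK : ∑ o, LinearMap.adjoint (K o) ∘ₗ K o = LinearMap.id := by
    rw [Fintype.sum_option]
    exact (congrArg₂ (· + ·)
      (adjoint_id_sub_comp hΦ.isSymmetricProjection_sum_partialTraceA_ketBra)
      (sum_sum_adjoint_comp_steer h hnorm (fun l => (hh l).2) Φ)).trans (sub_add_cancel _ P)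
  refine ⟨_, isLOCC_sum_conjBy_map hK U, fun k => ?_⟩
  have hnone : TensorProduct.map (U none).toLinearMap (K none) (Φ k) = 0 := by
    refine ext_bra (stdOrthonormalBasis ℂ A) fun i => ?_
    rw [bra_map, map_zero]
    exact sub_eq_zero.2 (hΦ.sum_partialTraceA_ketBra_bra k _).symm
  have hsome : ∀ p : κ, TensorProduct.map (U (some p)).toLinearMap (K (some p)) (Φ k) =
      if p.2.1 = k then u p.1 else 0 := fun p => hΦ.map_shift_steer _ _ _ _ _
  simp_rw [LinearMap.sum_apply, conjBy_ketBra, Fintype.sum_option, hnone, hsome, κ,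
    Fintype.sum_prod_type, apply_ite ketBra, ketBra_zero, zero_add]
  simp [hu, Finset.smul_sum, ← Nat.cast_smul_eq_nsmul ℂ]

lemma IsIsotropic.exists_orthonormalBasis [Nontrivial A] {R : E →ₗ[ℂ] A ⊗[ℂ] B}
    (hR : IsIsotropic R) :
    ∃ (b : OrthonormalBasis (Fin (Module.finrank ℂ E)) ℂ E) (μ : Fin (Module.finrank ℂ E) → ℝ),
      (∀ i, 0 ≤ μ i) ∧ ∀ ψ φ i j, inner ℂ (bra ψ (R (b i))) (bra φ (R (b j))) =
        if i = j then (μ j : ℂ) * inner ℂ φ ψ else 0 := by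
  obtain ⟨G, hG⟩ := hR
  obtain ⟨ψ₀, hψ₀⟩ := exists_norm_eq A zero_le_one
  have hGpos : G.IsPositive := by
    have : sliceGram R ψ₀ ψ₀ = G := by simp [hG, hψ₀]
    rw [← this, sliceGram_eq]
    exact LinearMap.isPositive_adjoint_comp_self _
  obtain ⟨b, μ, hμ, hb⟩ := exists_eigenbasis hGpos
  refine ⟨b, μ, hμ, fun ψ φ i j => ?_⟩
  rw [← inner_sliceGram, hG, LinearMap.smul_apply, hb, inner_smul_right, inner_smul_right,
    b.inner_eq_ite]
  split_ifs <;> ring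

lemma IsIsotropic.exists_isMaxEntangledFamily [Nontrivial A] {R : E →ₗ[ℂ] A ⊗[ℂ] B}
    (hR : IsIsotropic R) :
    ∃ (J : Type) (_ : Fintype J) (_ : DecidableEq J) (g : J → ℝ) (Φ : J → A ⊗[ℂ] B),
      IsMaxEntangledFamily Φ ∧ R ∘ₗ LinearMap.adjoint R = ∑ j, (g j : ℂ) • ketBra (Φ j) := by
  obtain ⟨b, μ, hμ, hinner⟩ := hR.exists_orthonormalBasis
  refine ⟨{j // μ j ≠ 0}, inferInstance, inferInstance, fun j => μ j,
    fun j => (((√(μ j))⁻¹ : ℝ) : ℂ) • R (b j), fun j k ψ φ => ?_, ?_⟩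
  · have hk : (((√(μ k))⁻¹ : ℝ) : ℂ) * (((√(μ k))⁻¹ : ℝ) : ℂ) * (μ k : ℂ) = 1 := by
      rw [← Complex.ofReal_mul, ← mul_inv, Real.mul_self_sqrt (hμ k), ← Complex.ofReal_mul,
        inv_mul_cancel₀ k.2, Complex.ofReal_one]
    rw [map_smul, map_smul, inner_smul_left, inner_smul_right, hinner, Complex.conj_ofReal]
    rcases eq_or_ne j k with rfl | hjk
    · rw [if_pos rfl, if_pos rfl, ← mul_assoc, ← mul_assoc, hk, one_mul]
    · rw [if_neg hjk, if_neg (Subtype.coe_ne_coe.2 hjk), mul_zero, mul_zero]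
  · have hzero : ∀ i, μ i = 0 → R (b i) = 0 := fun i hi =>
      ext_bra (stdOrthonormalBasis ℂ A) fun l => by
        rw [map_zero, ← inner_self_eq_zero (𝕜 := ℂ), hinner, if_pos rfl, hi, Complex.ofReal_zero,
          zero_mul]
    have hterm : ∀ j : {j // μ j ≠ 0}, (μ j : ℂ) • ketBra ((((√(μ j))⁻¹ : ℝ) : ℂ) • R (b j)) =
        ketBra (R (b j)) := fun j => by
      rw [ketBra_ofReal_smul, smul_smul, ← Complex.ofReal_mul, inv_pow, Real.sq_sqrt (hμ j),
        mul_inv_cancel₀ j.2, Complex.ofReal_one, one_smul]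
    rw [comp_adjoint_eq_sum_ketBra b, Finset.sum_congr rfl fun j _ => hterm j,
      ← Fintype.sum_subtype_add_sum_subtype (fun j => μ j ≠ 0), add_eq_left]
    exact Finset.sum_eq_zero fun i _ => by rw [hzero i (not_not.1 i.2), ketBra_zero]

lemma IsIsotropic.exists_isLOCC {R : E →ₗ[ℂ] A ⊗[ℂ] B} (hR : IsIsotropic R)
    {σ : A ⊗[ℂ] B →ₗ[ℂ] A ⊗[ℂ] B} (hσ : IsState σ) :
    ∃ Λ : (A ⊗[ℂ] B →ₗ[ℂ] A ⊗[ℂ] B) →ₗ[ℂ] (A ⊗[ℂ] B →ₗ[ℂ] A ⊗[ℂ] B), IsLOCC Λ ∧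
      Λ (R ∘ₗ LinearMap.adjoint R) = LinearMap.trace ℂ _ (R ∘ₗ LinearMap.adjoint R) • σ := by
  have := hσ.nontrivial_left
  obtain ⟨J, _, _, g, Φ, hΦ, hRΦ⟩ := hR.exists_isMaxEntangledFamily
  obtain ⟨Λ, hΛ, hΛΦ⟩ := hΦ.exists_isLOCC hσ
  refine ⟨Λ, hΛ, ?_⟩
  have htrace : ∀ k, LinearMap.trace ℂ _ (ketBra (Φ k)) = (Module.finrank ℂ A : ℂ) := fun k => by
    rw [trace_ketBra]
    exact_mod_cast hΦ.norm_sq_eq k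
  simp_rw [hRΦ, map_sum, map_smul, hΛΦ, htrace, Finset.sum_smul, smul_assoc]

lemma IsIsotropic.isSubnormalizedMES {R : E →ₗ[ℂ] A ⊗[ℂ] B} (hR : IsIsotropic R)
    (h0 : 0 < (LinearMap.trace ℂ _ (R ∘ₗ LinearMap.adjoint R)).re)
    (h1 : (LinearMap.trace ℂ _ (R ∘ₗ LinearMap.adjoint R)).re ≤ 1) :
    IsSubnormalizedMES (R ∘ₗ LinearMap.adjoint R) := by
  set q := (LinearMap.trace ℂ _ (R ∘ₗ LinearMap.adjoint R)).re with hq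
  have htrace : LinearMap.trace ℂ _ (R ∘ₗ LinearMap.adjoint R) = (q : ℂ) := by
    rw [hq, trace_comp_adjoint (stdOrthonormalBasis ℂ E), Complex.ofReal_re]
  have hq0 : (q : ℂ) ≠ 0 := Complex.ofReal_ne_zero.2 h0.ne'
  refine ⟨q, (q : ℂ)⁻¹ • (R ∘ₗ LinearMap.adjoint R), h0, h1, ⟨⟨?_, ?_⟩, fun σ hσ => ?_⟩,
    (smul_inv_smul₀ hq0 _).symm⟩
  · rw [← Complex.ofReal_inv]
    exact (LinearMap.isPositive_self_comp_adjoint R).smul_of_nonneg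
      (Complex.zero_le_real.2 (inv_nonneg.2 h0.le))
  · rw [map_smul, htrace, smul_eq_mul, inv_mul_cancel₀ hq0]
  · obtain ⟨Λ, hΛ, hΛR⟩ := hR.exists_isLOCC hσ
    exact ⟨Λ, hΛ, by rw [map_smul, hΛR, htrace, inv_smul_smul₀ hq0]⟩

lemma isIsotropic_zero : IsIsotropic (0 : E →ₗ[ℂ] A ⊗[ℂ] B) :=
  ⟨0, fun ψ φ => by simp only [smul_zero, sliceGram_eq, LinearMap.comp_zero]⟩

lemma IsIsotropic.finrank_le {R : E →ₗ[ℂ] A ⊗[ℂ] B} (hR : IsIsotropic R) (h0 : R ≠ 0) :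
    Module.finrank ℂ A ≤ Module.finrank ℂ B := by
  obtain ⟨G, hG⟩ := hR
  obtain ⟨e, he⟩ : ∃ e, R e ≠ 0 := by
    by_contra! hcon
    exact h0 (LinearMap.ext hcon)
  let h := stdOrthonormalBasis ℂ A
  have hinner : ∀ i j, inner ℂ (bra (h i) (R e)) (bra (h j) (R e)) =
      if j = i then inner ℂ e (G e) else (0 : ℂ) := fun i j => by
    rw [← inner_sliceGram, hG, LinearMap.smul_apply, inner_smul_right, h.inner_eq_ite, ite_mul,
      one_mul, zero_mul]
  have hGe : (inner ℂ e (G e) : ℂ) ≠ 0 := fun hz => he <| ext_bra h fun i => by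
    rw [map_zero, ← inner_self_eq_zero (𝕜 := ℂ), hinner, if_pos rfl, hz]
  have hli : LinearIndependent ℂ fun i => bra (h i) (R e) := by
    refine linearIndependent_of_ne_zero_of_inner_eq_zero (fun i hi => hGe ?_) fun i j hij => ?_
    · rw [← (hinner i i).trans (if_pos rfl), hi, inner_zero_left]
    · exact (hinner i j).trans (if_neg hij.symm)
  simpa using hli.fintype_card_le_finrank

lemma isIsotropic_iff {R : E →ₗ[ℂ] A ⊗[ℂ] B}
    (h1 : (LinearMap.trace ℂ _ (R ∘ₗ LinearMap.adjoint R)).re ≤ 1) :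
    IsIsotropic R ↔ (0 < (LinearMap.trace ℂ _ (R ∘ₗ LinearMap.adjoint R)).re →
      Module.finrank ℂ A ≤ Module.finrank ℂ B ∧ IsSubnormalizedMES (R ∘ₗ LinearMap.adjoint R)) := by
  refine ⟨fun hR h0 => ⟨hR.finrank_le ?_, hR.isSubnormalizedMES h0 h1⟩, fun h => ?_⟩
  · rintro rfl
    simp at h0
  · rcases eq_or_ne R 0 with rfl | hR
    · exact isIsotropic_zero
    · obtain ⟨hAB, hMES⟩ := h (re_trace_comp_adjoint_pos hR)
      exact hMES.isIsotropic hAB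

end LOCCProtocol

section POVM

variable {B : Type*} [NormedAddCommGroup B] [InnerProductSpace ℂ B] {d : ℕ}

lemma IsPOVM.isPositive_id_sub {M : Fin d → (B →ₗ[ℂ] B)} (hM : IsPOVM M) (k : Fin d) :
    (LinearMap.id - M k).IsPositive := by
  rw [← hM.2, ← Finset.sum_erase_eq_sub (Finset.mem_univ k)]
  exact LinearMap.isPositive_sum _ fun l _ => hM.1 l

end POVM

section Guess

variable {A B E : Type*} [NormedAddCommGroup A] [InnerProductSpace ℂ A] [FiniteDimensional ℂ A]
  [NormedAddCommGroup B] [InnerProductSpace ℂ B] [FiniteDimensional ℂ B]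
  [NormedAddCommGroup E] [InnerProductSpace ℂ E] [FiniteDimensional ℂ E] {d m : ℕ}

lemma condOp_comp_adjoint (ψ : A) (R : E →ₗ[ℂ] A ⊗[ℂ] B) :
    condOp ψ (R ∘ₗ LinearMap.adjoint R) = (bra ψ ∘ₗ R) ∘ₗ LinearMap.adjoint (bra ψ ∘ₗ R) := by
  rw [LinearMap.adjoint_comp, adjoint_bra, condOp, LinearMap.comp_assoc, LinearMap.comp_assoc]
  rfl

lemma trace_comp_map_ketBra (ψ : A) (M : B →ₗ[ℂ] B) (T : A ⊗[ℂ] B →ₗ[ℂ] A ⊗[ℂ] B) :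
    LinearMap.trace ℂ _ (T ∘ₗ TensorProduct.map (ketBra ψ) M) =
      LinearMap.trace ℂ B (condOp ψ T ∘ₗ M) := by
  have hmap : TensorProduct.map (ketBra ψ) M = TensorProduct.mk ℂ A B ψ ∘ₗ M ∘ₗ bra ψ :=
    TensorProduct.ext' fun a b => by simp [TensorProduct.smul_tmul]
  rw [hmap, ← LinearMap.comp_assoc, ← LinearMap.comp_assoc, LinearMap.trace_comp_comm']
  simp only [condOp, LinearMap.comp_assoc]
  rfl

lemma trace_eq_sum_condOp {ι : Type*} [Fintype ι] (h : OrthonormalBasis ι ℂ A)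
    (T : A ⊗[ℂ] B →ₗ[ℂ] A ⊗[ℂ] B) :
    LinearMap.trace ℂ _ T = ∑ i, LinearMap.trace ℂ B (condOp (h i) T) := by
  have hid : ∑ i, TensorProduct.map (ketBra (h i)) (LinearMap.id : B →ₗ[ℂ] B) = LinearMap.id := by
    rw [← TensorProduct.map_id, ← sum_ketBra h]
    exact (map_sum (LinearMap.rTensorHom B) _ _).symm
  conv_lhs => rw [← LinearMap.comp_id T, ← hid, ← Module.End.mul_eq_comp, Finset.mul_sum, map_sum]
  simp_rw [Module.End.mul_eq_comp, trace_comp_map_ketBra, LinearMap.comp_id]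

lemma guessProb_comp_adjoint (ψ : OrthonormalBasis (Fin d) ℂ A) (M : Fin d → (B →ₗ[ℂ] B))
    (R : E →ₗ[ℂ] A ⊗[ℂ] B) :
    guessProb ψ M (R ∘ₗ LinearMap.adjoint R) = ∑ k, LinearMap.trace ℂ E
      (LinearMap.adjoint (bra (ψ k) ∘ₗ R) ∘ₗ M k ∘ₗ (bra (ψ k) ∘ₗ R)) := by
  refine Finset.sum_congr rfl fun k _ => ?_
  rw [trace_comp_map_ketBra, condOp_comp_adjoint, LinearMap.comp_assoc, LinearMap.trace_comp_comm',
    LinearMap.comp_assoc]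

open scoped ComplexOrder in
lemma IsPOVM.apply_eq_zero_of_apply_eq_self {M : Fin d → (B →ₗ[ℂ] B)} (hM : IsPOVM M)
    {k l : Fin d} (hkl : k ≠ l) {v : B} (hv : M k v = v) : M l v = 0 := by
  have hsum : ∑ j ∈ Finset.univ.erase k, inner ℂ v (M j v) = (0 : ℂ) := by
    rw [← add_right_inj (inner ℂ v (M k v)),
      Finset.add_sum_erase _ (fun j => inner ℂ v (M j v)) (Finset.mem_univ k), ← inner_sum,
      ← LinearMap.sum_apply, hM.2, hv, add_zero, LinearMap.id_apply]
  refine apply_eq_zero_of_isPositive_of_inner (hM.1 l) ?_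
  exact (Finset.sum_eq_zero_iff_of_nonneg fun j _ => (hM.1 j).inner_nonneg_right v).1 hsum l
    (Finset.mem_erase.2 ⟨hkl.symm, Finset.mem_univ l⟩)

open scoped ComplexOrder in
lemma IsPOVM.comp_eq_self {M : Fin d → (B →ₗ[ℂ] B)} (hM : IsPOVM M) {S : Fin d → E →ₗ[ℂ] B}
    (hS : ∑ k, LinearMap.trace ℂ E (LinearMap.adjoint (S k) ∘ₗ M k ∘ₗ S k) =
      ∑ k, LinearMap.trace ℂ E (LinearMap.adjoint (S k) ∘ₗ S k)) (k : Fin d) :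
    M k ∘ₗ S k = S k := by
  have hpos : ∀ k, (LinearMap.adjoint (S k) ∘ₗ (LinearMap.id - M k) ∘ₗ S k).IsPositive :=
    fun k => (hM.isPositive_id_sub k).adjoint_conj (S k)
  have hsum : ∑ k, LinearMap.trace ℂ E (LinearMap.adjoint (S k) ∘ₗ (LinearMap.id - M k) ∘ₗ S k) =
      0 := by
    simp_rw [LinearMap.sub_comp, LinearMap.comp_sub, map_sub, Finset.sum_sub_distrib, hS,
      LinearMap.id_comp, sub_self]
  have hzero := eq_zero_of_isPositive_of_trace (hpos k)
    ((Finset.sum_eq_zero_iff_of_nonneg fun l _ => (hpos l).trace_nonneg).1 hsum k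
      (Finset.mem_univ k))
  refine LinearMap.ext fun x => (sub_eq_zero.1 ?_).symm
  refine apply_eq_zero_of_isPositive_of_inner (hM.isPositive_id_sub k) ?_
  change inner ℂ (S k x) ((LinearMap.id - M k : B →ₗ[ℂ] B) (S k x)) = 0
  rw [← LinearMap.adjoint_inner_right]
  exact (congrArg (inner ℂ x) (LinearMap.congr_fun hzero x)).trans (inner_zero_right x)

lemma isPOVM_starProjection {W : Fin d → Submodule ℂ B} (hW : Pairwise fun k l => W k ⟂ W l)
    (htop : ⨆ k, W k = ⊤) : IsPOVM fun k => ((W k).starProjection : B →ₗ[ℂ] B) := by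
  refine ⟨fun k => (W k).isSymmetricProjection_starProjection.isPositive,
    LinearMap.ext fun v => ?_⟩
  rw [LinearMap.sum_apply]
  exact (OrthogonalFamily.of_pairwise hW).sum_projection_of_mem_iSup v
    (htop ▸ Submodule.mem_top)

lemma exists_isPOVM_of_pairwise_isOrtho (k₀ : Fin d) {V : Fin d → Submodule ℂ B}
    (hV : Pairwise fun k l => V k ⟂ V l) :
    ∃ M : Fin d → (B →ₗ[ℂ] B), IsPOVM M ∧ ∀ k, ∀ v ∈ V k, M k v = v := by
  let N : Submodule ℂ B := ⨆ l, ⨆ _ : l ≠ k₀, V l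
  let W := Function.update V k₀ Nᗮ
  have hN : ∀ l, l ≠ k₀ → V l ≤ N := fun l hl => le_iSup₂_of_le l hl le_rfl
  have hW₀ : W k₀ = Nᗮ := Function.update_self ..
  have hW₁ : ∀ l, l ≠ k₀ → W l = V l := fun l hl => Function.update_of_ne hl ..
  have hVW : ∀ k, V k ≤ W k := by
    intro k
    rcases eq_or_ne k k₀ with rfl | hk
    · rw [hW₀, ← Submodule.isOrtho_iff_le]
      exact Submodule.isOrtho_iSup_right.2 fun l => Submodule.isOrtho_iSup_right.2 fun hl =>
        hV hl.symm
    · exact (hW₁ k hk).ge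
  have hort : Pairwise fun k l => W k ⟂ W l := by
    intro k l hkl
    rcases eq_or_ne k k₀ with rfl | hk
    · rw [hW₀, hW₁ l hkl.symm]
      exact ((Submodule.isOrtho_orthogonal_right N).mono_left (hN l hkl.symm)).symm
    · rcases eq_or_ne l k₀ with rfl | hl
      · rw [hW₀, hW₁ k hk]
        exact (Submodule.isOrtho_orthogonal_right N).mono_left (hN k hk)
      · rw [hW₁ k hk, hW₁ l hl]
        exact hV hkl
  have htop : ⨆ k, W k = ⊤ := by
    rw [eq_top_iff, ← Submodule.sup_orthogonal_of_hasOrthogonalProjection (K := N), ← hW₀]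
    exact sup_le (iSup₂_le fun l _ => (hVW l).trans (le_iSup W l)) (le_iSup W k₀)
  exact ⟨_, isPOVM_starProjection hort htop, fun k v hv =>
    Submodule.starProjection_eq_self_iff.2 (hVW k hv)⟩

lemma sum_trace_bra_comp_adjoint (ψ : OrthonormalBasis (Fin d) ℂ A) (R : E →ₗ[ℂ] A ⊗[ℂ] B) :
    ∑ k, LinearMap.trace ℂ E (LinearMap.adjoint (bra (ψ k) ∘ₗ R) ∘ₗ (bra (ψ k) ∘ₗ R)) =
      LinearMap.trace ℂ _ (R ∘ₗ LinearMap.adjoint R) := by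
  rw [trace_eq_sum_condOp ψ]
  exact Finset.sum_congr rfl fun k _ => by rw [condOp_comp_adjoint, LinearMap.trace_comp_comm']

lemma IsPOVM.sliceGram_eq_zero {M : Fin d → (B →ₗ[ℂ] B)} (hM : IsPOVM M)
    {ψ : OrthonormalBasis (Fin d) ℂ A} {R : E →ₗ[ℂ] A ⊗[ℂ] B}
    (hguess : guessProb ψ M (R ∘ₗ LinearMap.adjoint R) =
      LinearMap.trace ℂ _ (R ∘ₗ LinearMap.adjoint R)) {k l : Fin d} (hkl : k ≠ l) :
    sliceGram R (ψ k) (ψ l) = 0 := by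
  rw [guessProb_comp_adjoint, ← sum_trace_bra_comp_adjoint ψ] at hguess
  have hMS : ∀ k v, M k (bra (ψ k) (R v)) = bra (ψ k) (R v) :=
    fun k v => LinearMap.congr_fun (hM.comp_eq_self hguess k) v
  refine (sliceGram_eq_zero_iff R _ _).2 fun v w => ?_
  calc inner ℂ (bra (ψ k) (R v)) (bra (ψ l) (R w))
      = inner ℂ (M k (bra (ψ k) (R v))) (bra (ψ l) (R w)) := by rw [hMS]
    _ = inner ℂ (bra (ψ k) (R v)) (M k (bra (ψ l) (R w))) := (hM.1 k).isSymmetric _ _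
    _ = 0 := by rw [hM.apply_eq_zero_of_apply_eq_self hkl.symm (hMS l w), inner_zero_right]

lemma exists_isPOVM_guessProb_eq [NeZero d] {ψ : OrthonormalBasis (Fin d) ℂ A}
    {R : E →ₗ[ℂ] A ⊗[ℂ] B} (h : Pairwise fun k l => sliceGram R (ψ k) (ψ l) = 0) :
    ∃ M, IsPOVM M ∧ guessProb ψ M (R ∘ₗ LinearMap.adjoint R) =
      LinearMap.trace ℂ _ (R ∘ₗ LinearMap.adjoint R) := by
  obtain ⟨M, hM, hMS⟩ := exists_isPOVM_of_pairwise_isOrtho 0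
    (V := fun k => LinearMap.range (bra (ψ k) ∘ₗ R)) fun k l hkl => by
      refine Submodule.isOrtho_iff_inner_eq.2 ?_
      rintro _ ⟨v, rfl⟩ _ ⟨w, rfl⟩
      exact (sliceGram_eq_zero_iff R _ _).1 (h hkl) v w
  refine ⟨M, hM, ?_⟩
  rw [guessProb_comp_adjoint, ← sum_trace_bra_comp_adjoint ψ]
  refine Finset.sum_congr rfl fun k _ => congrArg _ (congrArg _ ?_)
  exact LinearMap.ext fun v => hMS k _ ⟨v, rfl⟩

lemma isZUS_iff {ℬ : Fin m → OrthonormalBasis (Fin d) ℂ A} {R : E →ₗ[ℂ] A ⊗[ℂ] B}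
    (hR : LinearMap.trace ℂ _ (R ∘ₗ LinearMap.adjoint R) = 1) :
    IsZUS ℬ (R ∘ₗ LinearMap.adjoint R) ↔
      ∀ x, Pairwise fun k l => sliceGram R (ℬ x k) (ℬ x l) = 0 := by
  refine forall_congr' fun x => ⟨fun ⟨M, hM, hguess⟩ k l hkl => ?_, fun h => ?_⟩
  · exact hM.sliceGram_eq_zero (hguess.trans hR.symm) hkl
  · have : NeZero d := ⟨by
      rintro rfl
      simp [← sum_trace_bra_comp_adjoint (ℬ x)] at hR⟩
    rw [← hR]
    exact exists_isPOVM_guessProb_eq h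

end Guess

section Isometry

variable {A E F : Type*} [NormedAddCommGroup A] [InnerProductSpace ℂ A] [FiniteDimensional ℂ A]
  [NormedAddCommGroup E] [InnerProductSpace ℂ E] [FiniteDimensional ℂ E]
  [NormedAddCommGroup F] [InnerProductSpace ℂ F] [FiniteDimensional ℂ F]

lemma norm_adjoint_apply_le {J : E →ₗ[ℂ] F} (hJ : LinearMap.adjoint J ∘ₗ J = LinearMap.id)
    (v : F) : ‖LinearMap.adjoint J v‖ ≤ ‖v‖ := by
  have hiso : ∀ e, ‖J e‖ = ‖e‖ := fun e => by
    rw [← sq_eq_sq₀ (norm_nonneg _) (norm_nonneg _), ← Complex.ofReal_inj, ← inner_self_eq_ofReal,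
      ← LinearMap.adjoint_inner_right, ← LinearMap.comp_apply, hJ, LinearMap.id_apply,
      inner_self_eq_ofReal]
  have hinner := norm_inner_le_norm (𝕜 := ℂ) v (J (LinearMap.adjoint J v))
  rw [← LinearMap.adjoint_inner_left, inner_self_eq_ofReal, Complex.norm_of_nonneg (by positivity),
    hiso] at hinner
  nlinarith [norm_nonneg v, norm_nonneg (LinearMap.adjoint J v)]

lemma trace_conjBy {J : E →ₗ[ℂ] F} (hJ : LinearMap.adjoint J ∘ₗ J = LinearMap.id)
    (T : E →ₗ[ℂ] E) : LinearMap.trace ℂ F (conjBy J T) = LinearMap.trace ℂ E T := by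
  change LinearMap.trace ℂ F (J ∘ₗ T ∘ₗ LinearMap.adjoint J) = _
  rw [LinearMap.trace_comp_comm', LinearMap.comp_assoc, hJ, LinearMap.comp_id]

lemma adjoint_subtype_comp_subtype (K : Submodule ℂ A) :
    LinearMap.adjoint K.subtype ∘ₗ K.subtype = LinearMap.id :=
  LinearMap.ext fun ψ => ext_inner_left ℂ fun φ => LinearMap.adjoint_inner_right K.subtype φ ψ

lemma starProjection_eq_subtype_comp_adjoint (K : Submodule ℂ A) :
    (K.starProjection : A →ₗ[ℂ] A) = K.subtype ∘ₗ LinearMap.adjoint K.subtype :=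
  LinearMap.ext fun ψ => congrArg K.subtype <| ext_inner_left ℂ fun φ => by
    rw [LinearMap.adjoint_inner_right]
    exact K.inner_orthogonalProjectionOnto_eq_of_mem_left φ ψ

lemma trace_starProjection (K : Submodule ℂ A) :
    LinearMap.trace ℂ A (K.starProjection : A →ₗ[ℂ] A) = Module.finrank ℂ K := by
  rw [starProjection_eq_subtype_comp_adjoint, LinearMap.trace_comp_comm',
    adjoint_subtype_comp_subtype, LinearMap.trace_id]

end Isometry

section Compression

variable {A B C E : Type*} [NormedAddCommGroup A] [InnerProductSpace ℂ A] [FiniteDimensional ℂ A]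
  [NormedAddCommGroup B] [InnerProductSpace ℂ B] [FiniteDimensional ℂ B]
  [NormedAddCommGroup C] [InnerProductSpace ℂ C] [FiniteDimensional ℂ C]
  [NormedAddCommGroup E] [InnerProductSpace ℂ E]

/-- The compression of an operator into `A ⊗ B` along `J : C → A`. If `J` is the inclusion of a
subspace `K`, then it is the factor of `restrictA K (R R†)`. -/
def compress (J : C →ₗ[ℂ] A) (R : E →ₗ[ℂ] A ⊗[ℂ] B) : E →ₗ[ℂ] C ⊗[ℂ] B :=
  (LinearMap.adjoint J).rTensor B ∘ₗ R

lemma bra_compress (J : C →ₗ[ℂ] A) (R : E →ₗ[ℂ] A ⊗[ℂ] B) (ψ : C) (e : E) :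
    bra ψ (compress J R e) = bra (J ψ) (R e) := by
  rw [compress, LinearMap.comp_apply, bra_rTensor, LinearMap.adjoint_adjoint]

variable [FiniteDimensional ℂ E]

lemma sliceGram_compress (J : C →ₗ[ℂ] A) (R : E →ₗ[ℂ] A ⊗[ℂ] B) (ψ φ : C) :
    sliceGram (compress J R) ψ φ = sliceGram R (J ψ) (J φ) :=
  LinearMap.ext fun e => ext_inner_left ℂ fun f => by
    rw [inner_sliceGram, inner_sliceGram, bra_compress, bra_compress]

lemma adjoint_rTensor_comp_self {J : C →ₗ[ℂ] A} (hJ : LinearMap.adjoint J ∘ₗ J = LinearMap.id) :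
    LinearMap.adjoint (J.rTensor B) ∘ₗ J.rTensor B = LinearMap.id := by
  rw [LinearMap.adjoint_rTensor, ← LinearMap.rTensor_comp, hJ, LinearMap.rTensor_id]

lemma re_trace_compress_le {J : C →ₗ[ℂ] A} (hJ : LinearMap.adjoint J ∘ₗ J = LinearMap.id)
    (R : E →ₗ[ℂ] A ⊗[ℂ] B) :
    (LinearMap.trace ℂ _ (compress J R ∘ₗ LinearMap.adjoint (compress J R))).re ≤
      (LinearMap.trace ℂ _ (R ∘ₗ LinearMap.adjoint R)).re := by
  simp_rw [trace_comp_adjoint (stdOrthonormalBasis ℂ E), Complex.ofReal_re]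
  gcongr with i
  rw [compress, ← LinearMap.adjoint_rTensor]
  exact norm_adjoint_apply_le (adjoint_rTensor_comp_self hJ) _

end Compression

section Support

variable {A B E F ι : Type*} [NormedAddCommGroup A] [InnerProductSpace ℂ A]
  [FiniteDimensional ℂ A] [NormedAddCommGroup B] [InnerProductSpace ℂ B] [FiniteDimensional ℂ B]
  [NormedAddCommGroup E] [InnerProductSpace ℂ E] [FiniteDimensional ℂ E]
  [NormedAddCommGroup F] [InnerProductSpace ℂ F] [FiniteDimensional ℂ F] [Fintype ι]

lemma inner_comp_adjoint_apply_self (S : E →ₗ[ℂ] B) (b : B) :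
    inner ℂ b ((S ∘ₗ LinearMap.adjoint S) b) = ((‖LinearMap.adjoint S b‖ ^ 2 : ℝ) : ℂ) := by
  rw [LinearMap.comp_apply, ← LinearMap.adjoint_inner_left, inner_self_eq_ofReal]

lemma ker_sum_comp_adjoint (S : ι → E →ₗ[ℂ] B) :
    LinearMap.ker (∑ i, S i ∘ₗ LinearMap.adjoint (S i)) =
      ⨅ i, LinearMap.ker (LinearMap.adjoint (S i)) := by
  ext b
  rw [LinearMap.mem_ker, Submodule.mem_iInf]
  refine ⟨fun h => ?_, fun h => ?_⟩
  · have hinner := congrArg (inner ℂ b) h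
    simp_rw [LinearMap.sum_apply, inner_sum, inner_comp_adjoint_apply_self] at hinner
    rw [inner_zero_right, ← Complex.ofReal_sum, Complex.ofReal_eq_zero,
      Finset.sum_eq_zero_iff_of_nonneg fun i _ => by positivity] at hinner
    exact fun i => norm_eq_zero.1 (sq_eq_zero_iff.1 (hinner i (Finset.mem_univ i)))
  · rw [LinearMap.sum_apply]
    refine Finset.sum_eq_zero fun i _ => ?_
    rw [LinearMap.comp_apply, LinearMap.mem_ker.1 (h i), map_zero]

lemma support_sum_comp_adjoint (S : ι → E →ₗ[ℂ] B) :
    support (∑ i, S i ∘ₗ LinearMap.adjoint (S i)) = ⨆ i, LinearMap.range (S i) := by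
  rw [support, ker_sum_comp_adjoint]
  simp_rw [← LinearMap.orthogonal_range]
  rw [Submodule.iInf_orthogonal, Submodule.orthogonal_orthogonal]

lemma support_partialTraceA_comp_adjoint (R : E →ₗ[ℂ] A ⊗[ℂ] B) :
    support (partialTraceA (R ∘ₗ LinearMap.adjoint R)) =
      ⨆ ψ : A, LinearMap.range (bra ψ ∘ₗ R) := by
  let h := stdOrthonormalBasis ℂ A
  simp_rw [partialTraceA_eq h, condOp_comp_adjoint, support_sum_comp_adjoint]
  refine le_antisymm (iSup_le fun i => le_iSup_of_le (h i) le_rfl) (iSup_le fun ψ => ?_)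
  rintro _ ⟨e, rfl⟩
  rw [← h.sum_repr' ψ]
  simp_rw [map_sum, map_smulₛₗ, LinearMap.comp_apply, LinearMap.sum_apply]
  exact Submodule.sum_mem _ fun i _ =>
    Submodule.smul_mem _ _ (Submodule.mem_iSup_of_mem i ⟨e, rfl⟩)

lemma isOrtho_support_partialTraceA_iff (R : E →ₗ[ℂ] A ⊗[ℂ] B) (S : F →ₗ[ℂ] A ⊗[ℂ] B) :
    support (partialTraceA (R ∘ₗ LinearMap.adjoint R)) ⟂
      support (partialTraceA (S ∘ₗ LinearMap.adjoint S)) ↔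
    ∀ ψ φ x y, inner ℂ (bra ψ (R x)) (bra φ (S y)) = (0 : ℂ) := by
  simp_rw [support_partialTraceA_comp_adjoint, Submodule.isOrtho_iSup_left,
    Submodule.isOrtho_iSup_right, Submodule.isOrtho_iff_inner_eq, LinearMap.mem_range,
    forall_exists_index, forall_apply_eq_imp_iff, LinearMap.comp_apply]

end Support

section Components

variable {HA : Type u} {HB : Type v}
  [NormedAddCommGroup HA] [InnerProductSpace ℂ HA]
  [NormedAddCommGroup HB] [InnerProductSpace ℂ HB] [FiniteDimensional ℂ HB]
  {E : Type*} [NormedAddCommGroup E] [InnerProductSpace ℂ E] [FiniteDimensional ℂ E]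
  {m d : ℕ}

lemma mem_supp_of_inner_ne_zero {ℬ : Fin m → OrthonormalBasis (Fin d) ℂ HA} {a : Component ℬ}
    {p q : Fin m × Fin d} (hp : p ∈ a.supp)
    (h : inner ℂ (ℬ p.1 p.2) (ℬ q.1 q.2) ≠ (0 : ℂ)) : q ∈ a.supp := by
  rcases eq_or_ne p q with rfl | hpq
  · exact hp
  · exact (SimpleGraph.ConnectedComponent.mem_supp_congr_adj a ⟨hpq, h⟩).1 hp

variable (ℬ : Fin m → OrthonormalBasis (Fin d) ℂ HA) (x : Fin m)
  (a b : Component ℬ)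

variable {ℬ a} in
lemma apply_mem_componentSubspace {y : Fin m} {k : Fin d} (hk : (y, k) ∈ a.supp) :
    ℬ y k ∈ componentSubspace ℬ x a := by
  rw [← (ℬ x).sum_repr' (ℬ y k)]
  refine Submodule.sum_mem _ fun l _ => ?_
  rcases eq_or_ne (inner ℂ (ℬ x l) (ℬ y k)) (0 : ℂ) with h0 | h0
  · rw [h0, zero_smul]
    exact Submodule.zero_mem _
  · refine Submodule.smul_mem _ _ (Submodule.subset_span ⟨l, ?_, rfl⟩)
    exact mem_supp_of_inner_ne_zero hk (inner_eq_zero_symm.not.1 h0)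

variable {ℬ a} in
lemma inner_eq_zero_of_mem_componentSubspace {y : Fin m} {k : Fin d} (hk : (y, k) ∉ a.supp)
    {ψ : HA} (hψ : ψ ∈ componentSubspace ℬ x a) : inner ℂ (ℬ y k) ψ = (0 : ℂ) := by
  suffices componentSubspace ℬ x a ≤ (ℂ ∙ ℬ y k)ᗮ from
    Submodule.mem_orthogonal_singleton_iff_inner_right.1 (this hψ)
  refine Submodule.span_le.2 ?_
  rintro _ ⟨l, hl, rfl⟩
  refine Submodule.mem_orthogonal_singleton_iff_inner_right.2 ?_
  by_contra h0
  exact hk (mem_supp_of_inner_ne_zero hl (inner_eq_zero_symm.not.1 h0))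

variable [FiniteDimensional ℂ HA]

lemma componentProj_eq_starProjection :
    componentProj ℬ x a = (componentSubspace ℬ x a).starProjection := by
  classical
  refine (ℬ x).toBasis.ext fun k => ?_
  have hsum : componentProj ℬ x a (ℬ x k) = if (x, k) ∈ a.supp then ℬ x k else 0 := by
    simp_rw [componentProj, LinearMap.sum_apply, ketBra_apply, (ℬ x).inner_eq_ite, ite_smul,
      one_smul, zero_smul, Finset.sum_ite_eq', Finset.mem_filter_univ]
  rw [OrthonormalBasis.coe_toBasis, hsum]
  split_ifs with hk
  · exact (Submodule.starProjection_eq_self_iff.2 (apply_mem_componentSubspace x hk)).symm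
  · refine ((Submodule.starProjection_apply_eq_zero_iff _).2 fun ψ hψ => ?_).symm
    exact inner_eq_zero_symm.1 (inner_eq_zero_of_mem_componentSubspace x hk hψ)

lemma componentRank_eq_finrank :
    componentRank ℬ x a = Module.finrank ℂ (componentSubspace ℬ x a) := by
  rw [componentRank, componentProj_eq_starProjection, trace_starProjection, Complex.natCast_re]

lemma componentState_eq_conjBy (T : HA ⊗[ℂ] HB →ₗ[ℂ] HA ⊗[ℂ] HB) :
    componentState ℬ x T a = conjBy ((componentSubspace ℬ x a).subtype.rTensor HB)
      (conjBy ((LinearMap.adjoint (componentSubspace ℬ x a).subtype).rTensor HB) T) := by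
  rw [componentState, componentProj_eq_starProjection, starProjection_eq_subtype_comp_adjoint,
    LinearMap.rTensor_comp, conjBy_conjBy]
  simp [conjBy, LinearMap.adjoint_comp, LinearMap.adjoint_rTensor]

variable (R : E →ₗ[ℂ] HA ⊗[ℂ] HB)

lemma componentState_comp_adjoint :
    componentState ℬ x (R ∘ₗ LinearMap.adjoint R) a =
      ((componentSubspace ℬ x a).subtype.rTensor HB ∘ₗ
        compress (componentSubspace ℬ x a).subtype R) ∘ₗ
      LinearMap.adjoint ((componentSubspace ℬ x a).subtype.rTensor HB ∘ₗ
        compress (componentSubspace ℬ x a).subtype R) := by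
  rw [componentState_eq_conjBy, conjBy_comp_adjoint, conjBy_comp_adjoint, compress]

lemma restrictA_componentState :
    restrictA (componentSubspace ℬ x a) (componentState ℬ x (R ∘ₗ LinearMap.adjoint R) a) =
      compress (componentSubspace ℬ x a).subtype R ∘ₗ
        LinearMap.adjoint (compress (componentSubspace ℬ x a).subtype R) := by
  rw [componentState_comp_adjoint, restrictA, conjBy_comp_adjoint, ← LinearMap.adjoint_rTensor,
    ← LinearMap.comp_assoc, adjoint_rTensor_comp_self (adjoint_subtype_comp_subtype _),
    LinearMap.id_comp]

lemma trace_componentState :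
    LinearMap.trace ℂ _ (componentState ℬ x (R ∘ₗ LinearMap.adjoint R) a) =
      LinearMap.trace ℂ _ (compress (componentSubspace ℬ x a).subtype R ∘ₗ
        LinearMap.adjoint (compress (componentSubspace ℬ x a).subtype R)) := by
  rw [componentState_eq_conjBy, conjBy_comp_adjoint,
    trace_conjBy (adjoint_rTensor_comp_self (adjoint_subtype_comp_subtype _))]
  rfl

lemma isOrtho_support_componentState_iff :
    support (partialTraceA (componentState ℬ x (R ∘ₗ LinearMap.adjoint R) a)) ⟂
      support (partialTraceA (componentState ℬ x (R ∘ₗ LinearMap.adjoint R) b)) ↔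
    ∀ ψ ∈ componentSubspace ℬ x a, ∀ φ ∈ componentSubspace ℬ x b, sliceGram R ψ φ = 0 := by
  have hbra : ∀ (K : Submodule ℂ HA) (ψ : HA) (e : E),
      bra ψ (K.subtype.rTensor HB (compress K.subtype R e)) = bra (K.starProjection ψ) (R e) :=
    fun K ψ e => by
      rw [bra_rTensor, bra_compress]
      exact congr(bra $((LinearMap.congr_fun (starProjection_eq_subtype_comp_adjoint K) ψ).symm)
        (R e))
  rw [componentState_comp_adjoint, componentState_comp_adjoint, isOrtho_support_partialTraceA_iff]
  simp_rw [LinearMap.comp_apply, hbra, sliceGram_eq_zero_iff]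
  refine ⟨fun h ψ hψ φ hφ => ?_, fun h ψ φ => ?_⟩
  · simpa only [Submodule.starProjection_eq_self_iff.2 hψ,
      Submodule.starProjection_eq_self_iff.2 hφ] using h ψ φ
  · exact h _ (Submodule.starProjection_apply_mem _ ψ) _ (Submodule.starProjection_apply_mem _ φ)

end Components

section Gram

variable {A B E ι : Type*} [NormedAddCommGroup A] [InnerProductSpace ℂ A] [FiniteDimensional ℂ A]
  [NormedAddCommGroup B] [InnerProductSpace ℂ B] [FiniteDimensional ℂ B]
  [NormedAddCommGroup E] [InnerProductSpace ℂ E] [FiniteDimensional ℂ E] [Fintype ι]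
  {R : E →ₗ[ℂ] A ⊗[ℂ] B}

lemma sliceGram_eq_sum {b : OrthonormalBasis ι ℂ A}
    (h : Pairwise fun k l => sliceGram R (b k) (b l) = 0) (ψ φ : A) :
    sliceGram R ψ φ =
      ∑ k, (inner ℂ φ (b k) * inner ℂ (b k) ψ) • sliceGram R (b k) (b k) := by
  classical
  have hk : ∀ k, sliceGram R (b k) φ = inner ℂ φ (b k) • sliceGram R (b k) (b k) := by
    intro k
    conv_lhs => rw [← b.sum_repr' φ, map_sum]
    simp_rw [map_smulₛₗ, inner_conj_symm]
    refine Fintype.sum_eq_single k fun l hl => ?_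
    rw [h hl.symm, smul_zero]
  conv_lhs => rw [← b.sum_repr' ψ, map_sum, LinearMap.sum_apply]
  refine Finset.sum_congr rfl fun k _ => ?_
  rw [map_smul, LinearMap.smul_apply, hk, smul_smul, mul_comm]

lemma sliceGram_self_eq_of_inner_ne_zero {κ : Type*} [Fintype κ] {b : OrthonormalBasis ι ℂ A}
    {c : OrthonormalBasis κ ℂ A}
    (hb : Pairwise fun k l => sliceGram R (b k) (b l) = 0)
    (hc : Pairwise fun k l => sliceGram R (c k) (c l) = 0)
    {k : ι} {l : κ} (hkl : inner ℂ (b k) (c l) ≠ (0 : ℂ)) :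
    sliceGram R (b k) (b k) = sliceGram R (c l) (c l) := by
  classical
  have hbk := sliceGram_eq_sum hb (b k) (c l)
  have hcl := sliceGram_eq_sum hc (b k) (c l)
  simp_rw [b.inner_eq_ite, mul_ite, mul_one, mul_zero, ite_smul, zero_smul,
    Finset.sum_ite_eq', Finset.mem_univ, if_true] at hbk
  simp_rw [c.inner_eq_ite, ite_mul, one_mul, zero_mul, ite_smul, zero_smul,
    Finset.sum_ite_eq, Finset.mem_univ, if_true] at hcl
  exact smul_right_injective _ (inner_eq_zero_symm.not.1 hkl) (hbk.symm.trans hcl)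

end Gram

section GramComponents

variable {HA : Type u} {HB : Type v}
  [NormedAddCommGroup HA] [InnerProductSpace ℂ HA] [FiniteDimensional ℂ HA]
  [NormedAddCommGroup HB] [InnerProductSpace ℂ HB] [FiniteDimensional ℂ HB]
  {E : Type*} [NormedAddCommGroup E] [InnerProductSpace ℂ E] [FiniteDimensional ℂ E]
  {m d : ℕ} {ℬ : Fin m → OrthonormalBasis (Fin d) ℂ HA} {R : E →ₗ[ℂ] HA ⊗[ℂ] HB}

lemma sliceGram_self_eq_of_mem_supp
    (h : ∀ y, Pairwise fun k l => sliceGram R (ℬ y k) (ℬ y l) = 0) {a : Component ℬ}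
    {p q : Fin m × Fin d} (hp : p ∈ a.supp) (hq : q ∈ a.supp) :
    sliceGram R (ℬ p.1 p.2) (ℬ p.1 p.2) = sliceGram R (ℬ q.1 q.2) (ℬ q.1 q.2) := by
  obtain ⟨w⟩ := SimpleGraph.ConnectedComponent.exact (hp.trans hq.symm)
  clear hp hq
  induction w with
  | nil => rfl
  | cons hadj _ ih => exact (sliceGram_self_eq_of_inner_ne_zero (h _) (h _) hadj.2).trans ih

lemma isIsotropic_compress_componentSubspace
    (h : ∀ y, Pairwise fun k l => sliceGram R (ℬ y k) (ℬ y l) = 0) (x : Fin m)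
    (a : Component ℬ) : IsIsotropic (compress (componentSubspace ℬ x a).subtype R) := by
  obtain ⟨p, hp⟩ := a.nonempty_supp
  refine ⟨sliceGram R (ℬ p.1 p.2) (ℬ p.1 p.2), fun ψ φ => ?_⟩
  rw [sliceGram_compress, Submodule.subtype_apply, Submodule.subtype_apply,
    sliceGram_eq_sum (h x), Submodule.coe_inner, ← (ℬ x).sum_inner_mul_inner, Finset.sum_smul]
  refine Finset.sum_congr rfl fun k _ => ?_
  by_cases hk : (x, k) ∈ a.supp
  · rw [sliceGram_self_eq_of_mem_supp h hp hk]
  · rw [inner_eq_zero_of_mem_componentSubspace x hk ψ.2, mul_zero,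
      zero_smul, zero_smul]

lemma sliceGram_eq_zero_of_mem_componentSubspace {x : Fin m}
    (h : Pairwise fun k l => sliceGram R (ℬ x k) (ℬ x l) = 0) {a b : Component ℬ} (hab : a ≠ b)
    {ψ φ : HA} (hψ : ψ ∈ componentSubspace ℬ x a) (hφ : φ ∈ componentSubspace ℬ x b) :
    sliceGram R ψ φ = 0 := by
  rw [sliceGram_eq_sum h]
  refine Finset.sum_eq_zero fun k _ => ?_
  by_cases hk : (x, k) ∈ a.supp
  · have hkb : (x, k) ∉ b.supp := fun hkb => hab (hk.symm.trans hkb)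
    rw [inner_eq_zero_symm.1 (inner_eq_zero_of_mem_componentSubspace x hkb hφ), zero_mul,
      zero_smul]
  · rw [inner_eq_zero_of_mem_componentSubspace x hk hψ, mul_zero, zero_smul]

lemma sliceGram_offDiag_eq_zero_iff (x : Fin m) :
    (∀ y, Pairwise fun k l => sliceGram R (ℬ y k) (ℬ y l) = 0) ↔
      (∀ a, IsIsotropic (compress (componentSubspace ℬ x a).subtype R)) ∧
      Pairwise fun a b => ∀ ψ ∈ componentSubspace ℬ x a, ∀ φ ∈ componentSubspace ℬ x b,
        sliceGram R ψ φ = 0 := by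
  refine ⟨fun h => ⟨isIsotropic_compress_componentSubspace h x, fun a b hab ψ hψ φ hφ =>
    sliceGram_eq_zero_of_mem_componentSubspace (h x) hab hψ hφ⟩, fun ⟨hiso, hpair⟩ y k l hkl => ?_⟩
  let a := (transitionGraph ℬ).connectedComponentMk (y, k)
  have hk : ℬ y k ∈ componentSubspace ℬ x a := apply_mem_componentSubspace x rfl
  by_cases hl : (y, l) ∈ a.supp
  · obtain ⟨G, hG⟩ := hiso a
    have := hG ⟨_, hk⟩ ⟨_, apply_mem_componentSubspace x hl⟩
    rwa [sliceGram_compress, Submodule.coe_inner, (ℬ y).inner_eq_zero hkl.symm, zero_smul] at this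
  · exact hpair (Ne.symm hl) _ hk _ (apply_mem_componentSubspace x rfl)

end GramComponents

end ZeroUncertainty

end

/-- The component data of a basis set do not depend on the index `x` of the basis through which
they are written; the theorem holds for every such choice. -/
theorem theorem2 {HA : Type*} {HB : Type*}
    [NormedAddCommGroup HA] [InnerProductSpace ℂ HA] [FiniteDimensional ℂ HA]
    [NormedAddCommGroup HB] [InnerProductSpace ℂ HB] [FiniteDimensional ℂ HB]
    {m d : ℕ} (ℬ : Fin m → OrthonormalBasis (Fin d) ℂ HA) (x : Fin m)
    (ρ : HA ⊗[ℂ] HB →ₗ[ℂ] HA ⊗[ℂ] HB) (hρ : IsState ρ) :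
    IsZUS ℬ ρ ↔
      (∀ a : Component ℬ,
        0 < (LinearMap.trace ℂ (HA ⊗[ℂ] HB) (componentState ℬ x ρ a)).re →
          componentRank ℬ x a ≤ (Module.finrank ℂ HB : ℝ)) ∧
      (∀ a : Component ℬ,
        0 < (LinearMap.trace ℂ (HA ⊗[ℂ] HB) (componentState ℬ x ρ a)).re →
          IsSubnormalizedMES (restrictA (componentSubspace ℬ x a) (componentState ℬ x ρ a))) ∧
      Pairwise (fun a b : Component ℬ =>
        support (partialTraceA (componentState ℬ x ρ a)) ⟂
          support (partialTraceA (componentState ℬ x ρ b))) := by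
  obtain ⟨n, R, rfl⟩ := exists_eq_comp_adjoint hρ.1
  have hle (a : Component ℬ) := (re_trace_compress_le (adjoint_subtype_comp_subtype
    (componentSubspace ℬ x a)) R).trans_eq (by rw [hρ.2, Complex.one_re])
  rw [isZUS_iff hρ.2, sliceGram_offDiag_eq_zero_iff x, ← and_assoc, ← forall_and]
  simp_rw [componentRank_eq_finrank, Nat.cast_le, trace_componentState, restrictA_componentState,
    isOrtho_support_componentState_iff, ← imp_and, ← isIsotropic_iff (hle _)]
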